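/- Let $\mathbb{K}$ be a field of characteristic zero. A noncrossing partition is a set partition $\pi$ of some $[n]=\{1,\dots,n\}$, $n\ge 1$, such that there are no distinct blocks $b\neq b'$ of $\pi$ and $x,z\in b$, $y,t\in b'$ with $x<y<z<t$; $|\pi|\ge 1$ is its number of blocks. Blocks are ordered by nesting: $b\le_\pi b'$ iff $b'\subseteq[\min b,\max b]$. For a set partition $\pi$ with $n$ blocks, $\mathrm{le}(\pi)$ is the number of bijections $f:\pi\to[n]$ such that $b\le_\pi b'$ implies $f(b)\le f(b')$. Let $\mathbb{K}[\mathcal{NCP}]$ be the free commutative algebra generated by all noncrossing partitions. For a nonempty set $Y$ of blocks of $\pi$, $\pi_{|Y}$ is the noncrossing partition obtained from $Y$ by the increasing relabelling of its elements; $\pi_{|\emptyset}=1$. A set $J$ of blocks is an ideal if each connected component (maximal interval) of $\bigcup J$ is a union of blocks, and then $\pi_{|_\cdot J}$ is the product over these components $C$ of $\pi_{|\{b\in\pi\,:\,b\subseteq C\}}$. For an equivalence $\sim$ on the set of blocks, $\pi/\!\sim$ is obtained by merging the blocks of each class, $\mathcal{E}_c[\pi]$ is the set of those $\sim$ for which $\pi/\!\sim$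 is noncrossing, and $\pi|_\cdot\!\sim$ is the product of the $\pi_{|c}$ over the classes $c$ of $\sim$. Equip $\mathbb{K}[\mathcal{NCP}]$ with the two multiplicative coproducts $$\Delta(\pi)=\sum_{J\text{ ideal of }\pi}\pi_{|\pi\setminus J}\otimes\pi_{|_\cdot J},\qquad \delta(\pi)=\sum_{\sim\in\mathcal{E}_c[\pi]}\pi/\!\sim\;\otimes\;\pi|_\cdot\!\sim,$$ with multiplicative counits $\varepsilon_\Delta(\pi)=0$, and $\epsilon_\delta(\pi)=1$ if $|\pi|=1$ and $0$ otherwise; equip $\mathbb{K}[X]$ with the multiplicative coproducts $\Delta(X)=X\otimes1+1\otimes X$, $\delta(X)=X\otimes X$ and the counits $P\mapsto P(0)$, $P\mapsto P(1)$ respectively. There is a unique algebra morphism $\phi_{\mathcal{NCP}}:\mathbb{K}[\mathcal{NCP}]\to\mathbb{K}[X]$ compatible with both coproducts and both counits. For every noncrossing partition $\pi$ with $n$ blocks, $\phi_{\mathcal{NCP}}(\pi)$ is a polynomial of degree $n$ with leading coefficient $\dfrac{\mathrm{le}(\pi)}{n!}$, and the coefficient of $X^{n-1}$ in $\phi_{\mathcal{NCP}}(\pi)$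 is $$-\frac{1}{(n-1)!}\left(\sum_{(b,b')\text{ close pair of }\pi}\mathrm{le}(\pi/(b,b'))+\frac12\sum_{(b,b')\text{ nested pair of }\pi}\mathrm{le}(\pi/(b,b'))\right).$$ Here $(b,b')$ is a close pair if $b\ne b'$ are blocks with $\max b<\min b'$ and there is a chain of blocks $b_1,\dots,b_k$ with $\max b_i+1=\min b_{i+1}$ for $1\le i<k$ going from $b$ to $b'$ or from $b'$ to $b$; $(b,b')$ is a nested pair if $b\ne b'$ are blocks, $b\le_\pi b'$, and no third block $b''$ satisfies $b\le_\pi b''\le_\pi b'$; and $\pi/(b,b')$ is the partition whose blocks are $b\cup b'$ and the other blocks of $\pi$. -/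

import Mathlib

open scoped TensorProduct

noncomputable section

namespace NoncrossingBialgebra

/-- No two distinct members `b`, `b'` of the family cross. -/
def IsNoncrossing (P : Finset (Finset ℕ)) : Prop :=
  ∀ b ∈ P, ∀ b' ∈ P, b ≠ b' → ∀ x ∈ b, ∀ z ∈ b, ∀ y ∈ b', ∀ t ∈ b',
    ¬ (x < y ∧ y < z ∧ z < t)

/-- A noncrossing partition of an arbitrary finite set of natural numbers (its `support`),
given by its set of blocks. -/
@[ext]
structure NCPartition where
  blocks : Finset (Finset ℕ)
  nonempty_of_mem : ∀ b ∈ blocks, b.Nonempty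
  disjoint : ∀ b ∈ blocks, ∀ b' ∈ blocks, b ≠ b' → Disjoint b b'
  noncrossing : IsNoncrossing blocks

namespace NCPartition

/-- The underlying finite set of the partition. -/
def support (π : NCPartition) : Finset ℕ := π.blocks.biUnion id

/-- The partition formed by the blocks of `π` that belong to `Y`, not yet relabelled. -/
def restrict (π : NCPartition) (Y : Finset (Finset ℕ)) : NCPartition where
  blocks := π.blocks ∩ Y
  nonempty_of_mem b hb := π.nonempty_of_mem b (Finset.mem_inter.1 hb).1
  disjoint b hb b' hb' :=
    π.disjoint b (Finset.mem_inter.1 hb).1 b' (Finset.mem_inter.1 hb').1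
  noncrossing b hb b' hb' :=
    π.noncrossing b (Finset.mem_inter.1 hb).1 b' (Finset.mem_inter.1 hb').1

end NCPartition

/-- The set `𝒩𝒞𝒫` of noncrossing partitions of the sets `[n] = {1, …, n}`, `n ≥ 1`
(there is no noncrossing partition with `0` blocks). -/
@[ext]
structure NCP extends NCPartition where
  blocks_nonempty : blocks.Nonempty
  support_eq : toNCPartition.support = Finset.Icc 1 toNCPartition.support.card

/-! ### Relabelling by an initial interval of the positive integers -/

/-- The position of `x` in the finite set `S`: on `S` this is the increasing bijection
from `S` to `{1, …, |S|}`. -/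
def rank (S : Finset ℕ) (x : ℕ) : ℕ := (S.filter (· ≤ x)).card

theorem rank_strictMonoOn (S : Finset ℕ) : StrictMonoOn (rank S) (S : Set ℕ) := by
  intro x _ y hy hxy
  apply Finset.card_lt_card
  rw [Finset.ssubset_iff_of_subset]
  · exact ⟨y, by simpa using hy, by simp [hxy]⟩
  · intro z hz
    simp only [Finset.mem_filter] at hz ⊢
    exact ⟨hz.1, hz.2.trans hxy.le⟩

theorem image_rank (S : Finset ℕ) : S.image (rank S) = Finset.Icc 1 S.card := by
  have hcard : (S.image (rank S)).card = S.card :=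
    Finset.card_image_of_injOn (rank_strictMonoOn S).injOn
  apply Finset.eq_of_subset_of_card_le
  · intro k hk
    obtain ⟨x, hx, rfl⟩ := Finset.mem_image.1 hk
    rw [Finset.mem_Icc]
    exact ⟨Finset.card_pos.2 ⟨x, by simp [hx]⟩, Finset.card_le_card (Finset.filter_subset _ _)⟩
  · rw [hcard]; simp

namespace NCPartition

theorem mem_support {π : NCPartition} {b : Finset ℕ} (hb : b ∈ π.blocks) {x : ℕ}
    (hx : x ∈ b) : x ∈ π.support :=
  Finset.mem_biUnion.2 ⟨b, hb, hx⟩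

/-- The partition `π` transported to `{1, …, |support π|}` along the increasing bijection. -/
def relabel (π : NCPartition) : NCPartition where
  blocks := π.blocks.image (fun b => b.image (rank π.support))
  nonempty_of_mem := by
    intro c hc
    obtain ⟨b, hb, rfl⟩ := Finset.mem_image.1 hc
    exact (π.nonempty_of_mem b hb).image _
  disjoint := by
    intro c hc c' hc' hne
    obtain ⟨b, hb, rfl⟩ := Finset.mem_image.1 hc
    obtain ⟨b', hb', rfl⟩ := Finset.mem_image.1 hc'
    have hbb : b ≠ b' := by rintro rfl; exact hne rfl
    rw [Finset.disjoint_left]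
    intro k hk hk'
    obtain ⟨x, hx, rfl⟩ := Finset.mem_image.1 hk
    obtain ⟨y, hy, hxy⟩ := Finset.mem_image.1 hk'
    have h := (rank_strictMonoOn π.support).injOn (mem_support hb' hy) (mem_support hb hx) hxy
    subst h
    exact Finset.disjoint_left.1 (π.disjoint b hb b' hb' hbb) hx hy
  noncrossing := by
    intro c hc c' hc' hne x hx z hz y hy t ht hlt
    obtain ⟨b, hb, rfl⟩ := Finset.mem_image.1 hc
    obtain ⟨b', hb', rfl⟩ := Finset.mem_image.1 hc'
    have hbb : b ≠ b' := by rintro rfl; exact hne rfl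
    obtain ⟨x, hx', rfl⟩ := Finset.mem_image.1 hx
    obtain ⟨z, hz', rfl⟩ := Finset.mem_image.1 hz
    obtain ⟨y, hy', rfl⟩ := Finset.mem_image.1 hy
    obtain ⟨t, ht', rfl⟩ := Finset.mem_image.1 ht
    have mono := rank_strictMonoOn π.support
    refine π.noncrossing b hb b' hb' hbb x hx' z hz' y hy' t ht'
      ⟨?_, ?_, ?_⟩
    · exact (mono.lt_iff_lt (mem_support hb hx') (mem_support hb' hy')).1 hlt.1
    · exact (mono.lt_iff_lt (mem_support hb' hy') (mem_support hb hz')).1 hlt.2.1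
    · exact (mono.lt_iff_lt (mem_support hb hz') (mem_support hb' ht')).1 hlt.2.2

theorem support_relabel (π : NCPartition) :
    π.relabel.support = Finset.Icc 1 π.support.card := by
  rw [← image_rank]
  ext k
  simp only [support, relabel, Finset.mem_biUnion, Finset.mem_image, id]
  constructor
  · rintro ⟨_, ⟨b, hb, rfl⟩, hk⟩
    obtain ⟨x, hx, rfl⟩ := Finset.mem_image.1 hk
    exact ⟨x, ⟨b, hb, hx⟩, rfl⟩
  · rintro ⟨x, ⟨b, hb, hx⟩, rfl⟩
    exact ⟨_, ⟨b, hb, rfl⟩, Finset.mem_image_of_mem _ hx⟩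

/-- The element of `𝒩𝒞𝒫` obtained by relabelling a nonempty noncrossing partition. -/
def standardize (π : NCPartition) (h : π.blocks.Nonempty) : NCP where
  toNCPartition := π.relabel
  blocks_nonempty := h.image _
  support_eq := by rw [support_relabel]; simp

end NCPartition

/-! ### The algebra `K[𝒩𝒞𝒫]` and its two coproducts -/

/-- The free commutative algebra generated by `𝒩𝒞𝒫`. -/
abbrev NCAlg (K : Type*) [Field K] : Type _ := MvPolynomial NCP K

variable (K : Type*) [Field K]

/-- The element of `K[𝒩𝒞𝒫]` given by a noncrossing partition after relabelling; the empty
partition gives the unit. -/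
def gen (π : NCPartition) : NCAlg K :=
  open Classical in
  if h : π.blocks.Nonempty then MvPolynomial.X (π.standardize h) else 1

namespace NCPartition

/-- The connected component of `x` in `S ⊆ U`: the elements `y` of `S` such that all the elements
of `U` between `x` and `y` are in `S`. -/
def component (U S : Finset ℕ) (x : ℕ) : Finset ℕ :=
  S.filter (fun y => ∀ z ∈ U, min x y ≤ z → z ≤ max x y → z ∈ S)

/-- The decomposition of `S ⊆ U` into its connected components, that is to say the maximal
intervals of `U` contained in `S`. -/
def components (U S : Finset ℕ) : Finset (Finset ℕ) := S.image (component U S)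

/-- The connected components of the union of a set `J` of blocks of `π`. -/
def componentsOf (π : NCPartition) (J : Finset (Finset ℕ)) : Finset (Finset ℕ) :=
  components π.support (J.biUnion id)

/-- The set `J` of blocks of `π` is an ideal: every connected component of the union of `J` is
a union of blocks of `π`. -/
def IsIdeal (π : NCPartition) (J : Finset (Finset ℕ)) : Prop :=
  J ⊆ π.blocks ∧ ∀ C ∈ π.componentsOf J, ∃ Q ⊆ π.blocks, C = Q.biUnion id

/-- The monomial attached to an ideal `J`: the product, over the connected components `C` of
the union of `J`, of the noncrossing partitions formed by the blocks of `π` contained in `C`. -/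
def restrictProd (π : NCPartition) (J : Finset (Finset ℕ)) : NCAlg K :=
  ∏ C ∈ π.componentsOf J, gen K (π.restrict (π.blocks.filter (· ⊆ C)))

/-- The blocks of `π / ∼`, for an equivalence `∼` on the blocks of `π` given by its classes: each
class is replaced by the union of its elements. -/
def quotientBlocks (π : NCPartition) (r : Finpartition π.blocks) : Finset (Finset ℕ) :=
  r.parts.image (fun c => c.biUnion id)

/-- The set `ℰ_c[π]` of the equivalences `∼` on the blocks of `π` such that `π / ∼` is
noncrossing. -/
def Contraction (π : NCPartition) : Type :=
  {r : Finpartition π.blocks // IsNoncrossing (π.quotientBlocks r)}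

instance (π : NCPartition) : Fintype π.Contraction :=
  open Classical in
  inferInstanceAs (Fintype {r : Finpartition π.blocks // IsNoncrossing (π.quotientBlocks r)})

/-- The noncrossing partition `π / ∼`. -/
def quotient (π : NCPartition) (r : π.Contraction) : NCPartition where
  blocks := π.quotientBlocks r.1
  nonempty_of_mem := by
    intro b hb
    obtain ⟨c, hc, rfl⟩ := Finset.mem_image.1 hb
    obtain ⟨a, ha⟩ := r.1.nonempty_of_mem_parts hc
    obtain ⟨x, hx⟩ := π.nonempty_of_mem a (r.1.subset hc ha)
    exact ⟨x, Finset.mem_biUnion.2 ⟨a, ha, hx⟩⟩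
  disjoint := by
    intro b hb b' hb' hne
    obtain ⟨c, hc, rfl⟩ := Finset.mem_image.1 hb
    obtain ⟨c', hc', rfl⟩ := Finset.mem_image.1 hb'
    have hcc : c ≠ c' := by rintro rfl; exact hne rfl
    have hd : Disjoint c c' := r.1.disjoint hc hc' hcc
    rw [Finset.disjoint_biUnion_left]
    intro a ha
    rw [Finset.disjoint_biUnion_right]
    intro a' ha'
    refine π.disjoint a (r.1.subset hc ha) a' (r.1.subset hc' ha') ?_
    rintro rfl
    exact Finset.disjoint_left.1 hd ha ha'
  noncrossing := r.2

/-- The monomial `π ∣ ∼`: the product of the restrictions of `π` to the classes of `∼`. -/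
def contractionProd (π : NCPartition) (r : π.Contraction) : NCAlg K :=
  ∏ c ∈ r.1.parts, gen K (π.restrict c)

end NCPartition

/-- The first coproduct `Δ` of `K[𝒩𝒞𝒫]`, the algebra morphism with
`Δ(π) = ∑_{J ideal of π} π_{∣ π ∖ J} ⊗ π_{∣· J}`. -/
def ncDelta1 : NCAlg K →ₐ[K] NCAlg K ⊗[K] NCAlg K :=
  open Classical in
  MvPolynomial.aeval fun π : NCP =>
    ∑ J ∈ π.blocks.powerset.filter π.IsIdeal,
      gen K (π.restrict (π.blocks \ J)) ⊗ₜ[K] π.restrictProd K J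

/-- The counit of `Δ` on `K[𝒩𝒞𝒫]`. -/
def ncCounit1 : NCAlg K →ₐ[K] K := MvPolynomial.aeval fun _ : NCP => (0 : K)

/-- The second coproduct `δ` of `K[𝒩𝒞𝒫]`, the algebra morphism with
`δ(π) = ∑_{∼ ∈ ℰ_c[π]} π / ∼ ⊗ π ∣· ∼`. -/
def ncDelta2 : NCAlg K →ₐ[K] NCAlg K ⊗[K] NCAlg K :=
  MvPolynomial.aeval fun π : NCP =>
    ∑ r : π.Contraction, gen K (π.quotient r) ⊗ₜ[K] π.contractionProd K r

/-- The counit of `δ` on `K[𝒩𝒞𝒫]`: it sends `π` to `1` if `π` has exactly one block, and to `0`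
otherwise. -/
def ncCounit2 : NCAlg K →ₐ[K] K :=
  MvPolynomial.aeval fun π : NCP => if π.blocks.card = 1 then (1 : K) else 0

/-! ### The double bialgebra `K[X]` -/

/-- The coproduct `Δ` of `K[X]`, with `Δ(X) = X ⊗ 1 + 1 ⊗ X`. -/
def polyDelta1 : Polynomial K →ₐ[K] Polynomial K ⊗[K] Polynomial K :=
  Polynomial.aeval (Polynomial.X ⊗ₜ[K] 1 + 1 ⊗ₜ[K] Polynomial.X)

/-- The counit of `Δ` on `K[X]`, `P ↦ P(0)`. -/
def polyCounit1 : Polynomial K →ₐ[K] K := Polynomial.aeval (0 : K)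

/-- The coproduct `δ` of `K[X]`, with `δ(X) = X ⊗ X`. -/
def polyDelta2 : Polynomial K →ₐ[K] Polynomial K ⊗[K] Polynomial K :=
  Polynomial.aeval (Polynomial.X ⊗ₜ[K] Polynomial.X)

/-- The counit of `δ` on `K[X]`, `P ↦ P(1)`. -/
def polyCounit2 : Polynomial K →ₐ[K] K := Polynomial.aeval (1 : K)

variable {K}

/-- Double bialgebra morphisms from `K[𝒩𝒞𝒫]` to `K[X]`: algebra morphisms that are compatible
with both coproducts and both counits. -/
structure IsDoubleBialgebraHom (φ : NCAlg K →ₐ[K] Polynomial K) : Prop where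
  map_delta1 : (Algebra.TensorProduct.map φ φ).comp (ncDelta1 K) = (polyDelta1 K).comp φ
  map_counit1 : (polyCounit1 K).comp φ = ncCounit1 K
  map_delta2 : (Algebra.TensorProduct.map φ φ).comp (ncDelta2 K) = (polyDelta2 K).comp φ
  map_counit2 : (polyCounit2 K).comp φ = ncCounit2 K

/-! ### Nesting order, linear extensions, close and nested pairs -/

/-- The least element of a nonempty block. -/
def bmin (b : Finset ℕ) : ℕ := if h : b.Nonempty then b.min' h else 0

/-- The greatest element of a nonempty block. -/
def bmax (b : Finset ℕ) : ℕ := if h : b.Nonempty then b.max' h else 0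

/-- The nesting order on blocks: `b ≤ b'` if `b' ⊆ [min b, max b]`. -/
def NestLE (b b' : Finset ℕ) : Prop := b' ⊆ Finset.Icc (bmin b) (bmax b)

/-- The number of linear extensions of the nesting order on a set of `n` blocks: the number of
bijections `f` onto `{0, …, n - 1}` such that `b ≤ b'` implies `f b ≤ f b'`. -/
def le (P : Finset (Finset ℕ)) : ℕ :=
  Nat.card {f : P ≃ Fin P.card // ∀ b b' : P, NestLE b b' → f b ≤ f b'}

namespace NCPartition

/-- `b` and `b'` are blocks of `π` and `b'` begins right after the end of `b`. -/
def Follows (π : NCPartition) (b b' : Finset ℕ) : Prop :=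
  b ∈ π.blocks ∧ b' ∈ π.blocks ∧ bmax b + 1 = bmin b'

/-- The relation `b ∼_π b'`: there is a chain of consecutive blocks from `b` to `b'` or from `b'`
to `b`. -/
def Sim (π : NCPartition) (b b' : Finset ℕ) : Prop :=
  Relation.ReflTransGen π.Follows b b' ∨ Relation.ReflTransGen π.Follows b' b

/-- Close pairs of blocks. -/
def IsClosePair (π : NCPartition) (b b' : Finset ℕ) : Prop :=
  b ∈ π.blocks ∧ b' ∈ π.blocks ∧ b ≠ b' ∧ bmax b < bmin b' ∧ π.Sim b b'

/-- Nested pairs of blocks. -/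
def IsNestedPair (π : NCPartition) (b b' : Finset ℕ) : Prop :=
  b ∈ π.blocks ∧ b' ∈ π.blocks ∧ b ≠ b' ∧ NestLE b b' ∧
    ∀ b'' ∈ π.blocks, NestLE b b'' → NestLE b'' b' → b'' = b ∨ b'' = b'

/-- The blocks of `π / (b, b')`: the union `b ∪ b'` and the other blocks of `π`. -/
def merge (π : NCPartition) (b b' : Finset ℕ) : Finset (Finset ℕ) :=
  insert (b ∪ b') (π.blocks \ {b, b'})

/-- The finite set of close pairs of `π`. -/
def closePairs (π : NCPartition) : Finset (Finset ℕ × Finset ℕ) :=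
  open Classical in
  (π.blocks ×ˢ π.blocks).filter fun p => π.IsClosePair p.1 p.2

/-- The finite set of nested pairs of `π`. -/
def nestedPairs (π : NCPartition) : Finset (Finset ℕ × Finset ℕ) :=
  open Classical in
  (π.blocks ×ˢ π.blocks).filter fun p => π.IsNestedPair p.1 p.2

end NCPartition

end NoncrossingBialgebra

end

/-! Colour the support of a noncrossing partition π with n colours, and call the colouring valid
(`NCPartition.Valid`) when two elements lie in one block exactly if they have equal colours and
nothing between them has a smaller colour. The number of valid colourings is a polynomial in n; this
polynomial is φ(π).

Both coproducts express ways of counting. With m + n colours, the blocks coloured at least m form an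
ideal J, and the colouring splits into a valid colouring of π ∖ J with m colours and one of each
component of J with n colours (`numColorings_add`). With m * n colours, write c = c₁ * n + c₂: for c
valid, c₁ is valid on exactly one quotient π/∼, and c₂ is valid on each class of ∼
(`numColorings_mul`). Having 0 or 1 colours gives the counits. In characteristic zero, values at
natural numbers determine polynomials, also in `K[X] ⊗ K[X]`, so these counts are identities of
morphisms. Uniqueness holds because Δ and the two counits fix the value of φ(π) at every natural
number by induction.

For the coefficients, sort colourings by the set of colours used: the count is ∑ s_k * choose(n, k)
with s_k = `numSurj π k`. A valid colouring with all blocks of different colours is a linear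
extension, so the top s_k is `le`. If π has m + 1 blocks, the next coefficient is (s_m - m * le / 2)
/ m!, and the theorem reduces to `mul_le_blocks`: m * le = (nested sum) + 2 * (s_m + close sum).

To see this, collapse two consecutive values of a linear extension. This gives an order preserving
surjection onto m values with one colliding pair, together with an admissible order of that pair. A
comparable pair has one such order; it is a nested pair, and the surjection is a linear extension of
the merged partition. An incomparable pair lies side by side and has two orders. If a block of
smaller value meets the gap, the surjection is a valid colouring; if none does, the pair is close
and the surjection is again a linear extension of the merged partition. -/

namespace NoncrossingBialgebra

/-! ### Counting functions given piecewise on disjoint sets -/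

open scoped Classical in
/-- The functions on `ℕ` that vanish off `U` and take values in `A` on `U`. -/
noncomputable def funs (U A : Finset ℕ) : Finset (ℕ → ℕ) :=
  (Finset.univ : Finset (U → A)).image fun g x => if h : x ∈ U then (g ⟨x, h⟩ : ℕ) else 0

theorem mem_funs {U A : Finset ℕ} {c : ℕ → ℕ} :
    c ∈ funs U A ↔ (∀ x ∈ U, c x ∈ A) ∧ ∀ x ∉ U, c x = 0 := by
  simp only [funs, Finset.mem_image, Finset.mem_univ, true_and]
  constructor
  · rintro ⟨g, rfl⟩
    exact ⟨fun x hx => by simp [hx], fun x hx => by simp [hx]⟩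
  · rintro ⟨h1, h2⟩
    refine ⟨fun x => ⟨c x, h1 x x.2⟩, ?_⟩
    funext x
    by_cases hx : x ∈ U
    · simp [hx]
    · simp [hx, h2 x hx]

/-- A property of functions that depends only on the values on `U`. -/
def LocalOn (U : Finset ℕ) (P : (ℕ → ℕ) → Prop) : Prop :=
  ∀ c c' : ℕ → ℕ, (∀ x ∈ U, c x = c' x) → P c → P c'

/-- Since functions in `funs` vanish off their set, a pair is glued by adding and recovered by
restricting. The family `F` is given through its members so that colourings of quite different
shapes can be fed in. -/
theorem card_glue_pair {U V A B : Finset ℕ} (hUV : Disjoint U V) {P Q : (ℕ → ℕ) → Prop}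
    [DecidablePred P] [DecidablePred Q]
    (hP : LocalOn U P) (hQ : LocalOn V Q) {F : Finset (ℕ → ℕ)}
    (hF : ∀ c, c ∈ F ↔ (∀ x ∈ U, c x ∈ A) ∧ (∀ x ∈ V, c x ∈ B) ∧
      (∀ x, x ∉ U → x ∉ V → c x = 0) ∧ P c ∧ Q c) :
    F.card = ((funs U A).filter P).card * ((funs V B).filter Q).card := by
  have hV : ∀ x ∈ U, x ∉ V := fun x hx hx' => Finset.disjoint_left.1 hUV hx hx'
  have hU : ∀ x ∈ V, x ∉ U := fun x hx hx' => Finset.disjoint_left.1 hUV hx' hx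
  rw [← Finset.card_product]
  refine Finset.card_nbij'
    (fun c => (fun x => if x ∈ U then c x else 0, fun x => if x ∈ V then c x else 0))
    (fun p x => p.1 x + p.2 x) ?_ ?_ ?_ ?_
  · intro c hc
    obtain ⟨h1, h2, h3, h4, h5⟩ := (hF c).1 hc
    simp only [Finset.coe_product, Finset.coe_filter, Set.mem_prod, Set.mem_ofPred_eq, mem_funs]
    refine ⟨⟨⟨fun x hx => by simp [hx, h1 x hx], fun x hx => by simp [hx]⟩, ?_⟩,
      ⟨⟨fun x hx => by simp [hx, h2 x hx], fun x hx => by simp [hx]⟩, ?_⟩⟩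
    · exact hP _ _ (fun x hx => by simp [hx]) h4
    · exact hQ _ _ (fun x hx => by simp [hx]) h5
  · rintro ⟨c, d⟩ h
    simp only [Finset.coe_product, Finset.coe_filter, Set.mem_prod, Set.mem_ofPred_eq, mem_funs] at h
    obtain ⟨⟨⟨h1, h2⟩, h3⟩, ⟨h4, h5⟩, h6⟩ := h
    rw [Finset.mem_coe, hF]
    refine ⟨fun x hx => by simp [h5 x (hV x hx), h1 x hx],
      fun x hx => by simp [h2 x (hU x hx), h4 x hx],
      fun x hx hx' => by simp [h2 x hx, h5 x hx'], ?_, ?_⟩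
    · exact hP _ _ (fun x hx => by simp [h5 x (hV x hx)]) h3
    · exact hQ _ _ (fun x hx => by simp [h2 x (hU x hx)]) h6
  · intro c hc
    obtain ⟨h1, h2, h3, h4, h5⟩ := (hF c).1 hc
    funext x
    by_cases hx : x ∈ U
    · simp [hx, hV x hx]
    · by_cases hx' : x ∈ V
      · simp [hx, hx']
      · simp [hx, hx', h3 x hx hx']
  · rintro ⟨c, d⟩ h
    simp only [Finset.coe_product, Finset.coe_filter, Set.mem_prod, Set.mem_ofPred_eq, mem_funs] at h
    obtain ⟨⟨⟨h1, h2⟩, h3⟩, ⟨h4, h5⟩, h6⟩ := h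
    ext x
    · by_cases hx : x ∈ U
      · simp [hx, h5 x (hV x hx)]
      · simp [hx, h2 x hx]
    · by_cases hx : x ∈ V
      · simp [hx, h2 x (hU x hx)]
      · simp [hx, h5 x hx]

open scoped Classical in
theorem card_glue {ι : Type*} (T : Finset ι) (U : ι → Finset ℕ) (A : Finset ℕ)
    (hU : ∀ i ∈ T, ∀ j ∈ T, i ≠ j → Disjoint (U i) (U j)) (Q : ι → (ℕ → ℕ) → Prop)
    (hQ : ∀ i ∈ T, LocalOn (U i) (Q i)) :
    ((funs (T.biUnion U) A).filter fun c => ∀ i ∈ T, Q i c).card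
      = ∏ i ∈ T, ((funs (U i) A).filter (Q i)).card := by
  induction T using Finset.induction_on with
  | empty =>
    simp only [Finset.biUnion_empty, Finset.prod_empty, Finset.card_eq_one]
    refine ⟨fun _ => 0, ?_⟩
    ext c
    simp [mem_funs, funext_iff]
  | insert i T hi ih =>
    rw [Finset.prod_insert hi, ← ih (fun j hj k hk => hU j (Finset.mem_insert_of_mem hj) k
      (Finset.mem_insert_of_mem hk)) (fun j hj => hQ j (Finset.mem_insert_of_mem hj))]
    apply card_glue_pair
    · rw [Finset.disjoint_biUnion_right]
      intro j hj
      refine hU i (Finset.mem_insert_self _ _) j (Finset.mem_insert_of_mem hj) ?_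
      rintro rfl
      exact hi hj
    · exact hQ i (Finset.mem_insert_self _ _)
    · intro c c' h hc j hj
      exact hQ j (Finset.mem_insert_of_mem hj) c c'
        (fun x hx => h x (Finset.mem_biUnion.2 ⟨j, hj, hx⟩)) (hc j hj)
    · intro c
      simp only [Finset.mem_filter, mem_funs, Finset.biUnion_insert, Finset.mem_union,
        Finset.forall_mem_insert, not_or, and_imp, or_imp, forall_and]
      tauto

/-! ### Level components and valid colourings -/

/-- `x` and `y` are in the same level component of the colouring `c` of `S`. -/
def LevelRel (S : Finset ℕ) (c : ℕ → ℕ) (x y : ℕ) : Prop :=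
  c x = c y ∧ ∀ z ∈ S, min x y ≤ z → z ≤ max x y → c x ≤ c z

theorem LevelRel.refl (S : Finset ℕ) (c : ℕ → ℕ) (x : ℕ) : LevelRel S c x x := by
  refine ⟨rfl, fun z _ h1 h2 => ?_⟩
  have : z = x := by simp at h1 h2; omega
  rw [this]

theorem LevelRel.symm {S : Finset ℕ} {c : ℕ → ℕ} {x y : ℕ} (h : LevelRel S c x y) :
    LevelRel S c y x :=
  ⟨h.1.symm, fun z hz h1 h2 => h.1 ▸ h.2 z hz (by rwa [min_comm]) (by rwa [max_comm])⟩

theorem LevelRel.trans {S : Finset ℕ} {c : ℕ → ℕ} {x y w : ℕ} (h : LevelRel S c x y)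
    (h' : LevelRel S c y w) : LevelRel S c x w := by
  refine ⟨h.1.trans h'.1, fun z hz h1 h2 => ?_⟩
  by_cases hxy : min x y ≤ z ∧ z ≤ max x y
  · exact h.2 z hz hxy.1 hxy.2
  · rw [h.1]
    apply h'.2 z hz <;> omega

theorem LevelRel.congr {S : Finset ℕ} {c c' : ℕ → ℕ} {x y : ℕ} (hx : x ∈ S) (hy : y ∈ S)
    (hc : ∀ z ∈ S, c z = c' z) (h : LevelRel S c x y) : LevelRel S c' x y := by
  refine ⟨by rw [← hc x hx, ← hc y hy, h.1], fun z hz h1 h2 => ?_⟩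
  rw [← hc x hx, ← hc z hz]
  exact h.2 z hz h1 h2

namespace NCPartition

/-- `x` and `y` are in the same block of `π`. -/
def Same (π : NCPartition) (x y : ℕ) : Prop := ∃ b ∈ π.blocks, x ∈ b ∧ y ∈ b

/-- The blocks of `π` are the level components of the colouring `c`. -/
def Valid (π : NCPartition) (c : ℕ → ℕ) : Prop :=
  ∀ x ∈ π.support, ∀ y ∈ π.support, π.Same x y ↔ LevelRel π.support c x y

theorem valid_local (π : NCPartition) : LocalOn π.support π.Valid := by
  intro c c' h hc x hx y hy
  rw [hc x hx y hy]
  exact ⟨LevelRel.congr hx hy h, LevelRel.congr hx hy fun z hz => (h z hz).symm⟩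

theorem mem_support_iff {π : NCPartition} {x : ℕ} : x ∈ π.support ↔ ∃ b ∈ π.blocks, x ∈ b := by
  simp [support]

theorem block_unique {π : NCPartition} {b b' : Finset ℕ} (hb : b ∈ π.blocks)
    (hb' : b' ∈ π.blocks) {x : ℕ} (hx : x ∈ b) (hx' : x ∈ b') : b = b' := by
  by_contra h
  exact Finset.disjoint_left.1 (π.disjoint b hb b' hb' h) hx hx'

theorem same_iff {π : NCPartition} {b : Finset ℕ} (hb : b ∈ π.blocks) {x y : ℕ} (hx : x ∈ b) :
    π.Same x y ↔ y ∈ b :=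
  ⟨fun ⟨_, hb', h1, h2⟩ => block_unique hb' hb h1 hx ▸ h2, fun h => ⟨b, hb, hx, h⟩⟩

open scoped Classical in
/-- The valid colourings of `π` with colours in `A`. -/
noncomputable def colorings (π : NCPartition) (A : Finset ℕ) : Finset (ℕ → ℕ) :=
  (funs π.support A).filter π.Valid

/-- The number of valid colourings of `π` with `n` colours. -/
noncomputable def numColorings (π : NCPartition) (n : ℕ) : ℕ :=
  (π.colorings (Finset.range n)).card

theorem mem_colorings {π : NCPartition} {A : Finset ℕ} {c : ℕ → ℕ} :
    c ∈ π.colorings A ↔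
      (∀ x ∈ π.support, c x ∈ A) ∧ (∀ x ∉ π.support, c x = 0) ∧ π.Valid c := by
  simp [colorings, mem_funs, and_assoc]

/-! ### Invariance under relabelling -/

theorem same_relabel {π : NCPartition} {x y : ℕ} (hx : x ∈ π.support) (hy : y ∈ π.support) :
    π.relabel.Same (rank π.support x) (rank π.support y) ↔ π.Same x y := by
  have inj := (rank_strictMonoOn π.support).injOn
  constructor
  · rintro ⟨c, hc, h1, h2⟩
    obtain ⟨b, hb, rfl⟩ := Finset.mem_image.1 hc
    obtain ⟨x', hx', h1⟩ := Finset.mem_image.1 h1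
    obtain ⟨y', hy', h2⟩ := Finset.mem_image.1 h2
    have e1 := inj (mem_support hb hx') hx h1
    have e2 := inj (mem_support hb hy') hy h2
    subst e1 e2
    exact ⟨b, hb, hx', hy'⟩
  · rintro ⟨b, hb, h1, h2⟩
    exact ⟨_, Finset.mem_image_of_mem _ hb, Finset.mem_image_of_mem _ h1,
      Finset.mem_image_of_mem _ h2⟩

theorem support_relabel_eq_image (π : NCPartition) :
    π.relabel.support = π.support.image (rank π.support) := by
  rw [support_relabel, image_rank]

theorem valid_relabel {π : NCPartition} {c d : ℕ → ℕ}
    (h : ∀ x ∈ π.support, d x = c (rank π.support x)) : π.relabel.Valid c ↔ π.Valid d := by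
  have mono := rank_strictMonoOn π.support
  have key : ∀ x ∈ π.support, ∀ y ∈ π.support,
      LevelRel π.relabel.support c (rank π.support x) (rank π.support y) ↔
        LevelRel π.support d x y := by
    intro x hx y hy
    have hmin : min (rank π.support x) (rank π.support y) = rank π.support (min x y) := by
      rcases le_total x y with hxy | hxy
      · rw [min_eq_left hxy, min_eq_left ((mono.le_iff_le hx hy).2 hxy)]
      · rw [min_eq_right hxy, min_eq_right ((mono.le_iff_le hy hx).2 hxy)]
    have hmax : max (rank π.support x) (rank π.support y) = rank π.support (max x y) := by
      rcases le_total x y with hxy | hxy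
      · rw [max_eq_right hxy, max_eq_right ((mono.le_iff_le hx hy).2 hxy)]
      · rw [max_eq_left hxy, max_eq_left ((mono.le_iff_le hy hx).2 hxy)]
    have hm1 : min x y ∈ π.support := by rcases min_choice x y with e | e <;> rw [e] <;> assumption
    have hm2 : max x y ∈ π.support := by rcases max_choice x y with e | e <;> rw [e] <;> assumption
    unfold LevelRel
    rw [support_relabel_eq_image, Finset.forall_mem_image, hmin, hmax, h x hx, h y hy]
    refine and_congr_right fun _ => forall₂_congr fun z hz => ?_
    rw [mono.le_iff_le hm1 hz, mono.le_iff_le hz hm2, h z hz]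
  unfold Valid
  rw [support_relabel_eq_image, Finset.forall_mem_image]
  refine forall₂_congr fun x hx => ?_
  rw [Finset.forall_mem_image]
  refine forall₂_congr fun y hy => ?_
  rw [same_relabel hx hy, ← support_relabel_eq_image, key x hx y hy]

theorem numColorings_relabel (π : NCPartition) (n : ℕ) :
    π.relabel.numColorings n = π.numColorings n := by
  have mono := rank_strictMonoOn π.support
  refine Finset.card_nbij (fun c x => if x ∈ π.support then c (rank π.support x) else 0) ?_ ?_ ?_
  · intro c hc
    simp only [Finset.mem_coe, mem_colorings, support_relabel_eq_image,
      Finset.forall_mem_image] at hc ⊢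
    refine ⟨fun x hx => by simpa [hx] using! hc.1 hx, fun x hx => by simp [hx], ?_⟩
    exact (valid_relabel fun x hx => by simp [hx]).1 hc.2.2
  · intro c hc c' hc' h
    simp only [Finset.mem_coe, mem_colorings, support_relabel_eq_image] at hc hc'
    funext k
    by_cases hk : k ∈ π.support.image (rank π.support)
    · obtain ⟨x, hx, rfl⟩ := Finset.mem_image.1 hk
      have := congrFun h x
      simpa [hx] using this
    · rw [hc.2.1 k hk, hc'.2.1 k hk]
  · intro d hd
    simp only [Finset.mem_coe, mem_colorings] at hd
    have hinv : ∀ x ∈ π.support,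
        Function.invFunOn (rank π.support) π.support (rank π.support x) = x := fun x hx =>
      mono.injOn (Function.invFunOn_mem ⟨x, hx, rfl⟩) hx (Function.invFunOn_eq ⟨x, hx, rfl⟩)
    refine ⟨fun k => if k ∈ π.relabel.support then
      d (Function.invFunOn (rank π.support) π.support k) else 0, ?_, ?_⟩
    · have hc : ∀ x ∈ π.support, d x = (fun k => if k ∈ π.relabel.support then
          d (Function.invFunOn (rank π.support) π.support k) else 0) (rank π.support x) := by
        intro x hx
        have : rank π.support x ∈ π.relabel.support := by
          rw [support_relabel_eq_image]; exact Finset.mem_image_of_mem _ hx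
        simp [this, hinv x hx]
      simp only [Finset.mem_coe, mem_colorings]
      refine ⟨?_, fun x hx => by simp [hx], (valid_relabel hc).2 hd.2.2⟩
      rw [support_relabel_eq_image, Finset.forall_mem_image]
      intro x hx
      have := hc x hx
      rw [← support_relabel_eq_image]
      simp only at this
      rw [← this]
      exact hd.1 x hx
    · funext x
      by_cases hx : x ∈ π.support
      · have : rank π.support x ∈ π.relabel.support := by
          rw [support_relabel_eq_image]; exact Finset.mem_image_of_mem _ hx
        simp [hx, this, hinv x hx]
      · simp [hx, hd.2.1 x hx]

/-! ### Connected components, ideals and the coproduct Δ -/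

theorem mem_component {U T : Finset ℕ} {x y : ℕ} :
    y ∈ component U T x ↔ y ∈ T ∧ ∀ z ∈ U, min x y ≤ z → z ≤ max x y → z ∈ T := by
  simp [component]

theorem self_mem_component {U T : Finset ℕ} {x : ℕ} (hx : x ∈ T) : x ∈ component U T x := by
  refine mem_component.2 ⟨hx, fun z _ h1 h2 => ?_⟩
  have : z = x := by simp at h1 h2; omega
  rwa [this]

theorem component_trans {U T : Finset ℕ} {x y w : ℕ} (hy : y ∈ component U T x)
    (hw : w ∈ component U T y) : w ∈ component U T x := by
  rw [mem_component] at *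
  refine ⟨hw.1, fun z hz h1 h2 => ?_⟩
  by_cases hxy : min x y ≤ z ∧ z ≤ max x y
  · exact hy.2 z hz hxy.1 hxy.2
  · apply hw.2 z hz <;> omega

theorem component_symm {U T : Finset ℕ} {x y : ℕ} (hx : x ∈ T) (hy : y ∈ component U T x) :
    x ∈ component U T y := by
  rw [mem_component] at *
  exact ⟨hx, fun z hz h1 h2 => hy.2 z hz (by rwa [min_comm]) (by rwa [max_comm])⟩

theorem component_eq {U T : Finset ℕ} {x y : ℕ} (hx : x ∈ T) (hy : y ∈ component U T x) :
    component U T y = component U T x := by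
  ext w
  exact ⟨component_trans hy, component_trans (component_symm hx hy)⟩

theorem eq_component {U T C : Finset ℕ} (hC : C ∈ components U T) {x : ℕ} (hx : x ∈ C) :
    x ∈ T ∧ C = component U T x := by
  obtain ⟨w, hw, rfl⟩ := Finset.mem_image.1 hC
  exact ⟨(mem_component.1 hx).1, (component_eq hw hx).symm⟩

theorem biUnion_components (U T : Finset ℕ) : (components U T).biUnion id = T := by
  ext x
  simp only [Finset.mem_biUnion, id]
  constructor
  · rintro ⟨C, hC, hx⟩
    exact (eq_component hC hx).1
  · intro hx
    exact ⟨_, Finset.mem_image_of_mem _ hx, self_mem_component hx⟩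

theorem components_disjoint {U T C C' : Finset ℕ} (hC : C ∈ components U T)
    (hC' : C' ∈ components U T) (h : C ≠ C') : Disjoint C C' := by
  rw [Finset.disjoint_left]
  intro x hx hx'
  exact h ((eq_component hC hx).2.trans (eq_component hC' hx').2.symm)

theorem support_restrict {π : NCPartition} {Y : Finset (Finset ℕ)} (hY : Y ⊆ π.blocks) :
    (π.restrict Y).support = Y.biUnion id := by
  simp only [support, restrict, Finset.inter_eq_right.2 hY]

theorem same_restrict {π : NCPartition} {Y : Finset (Finset ℕ)} (hY : Y ⊆ π.blocks) {x y : ℕ}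
    (hx : x ∈ Y.biUnion id) : (π.restrict Y).Same x y ↔ π.Same x y := by
  obtain ⟨b, hb, hxb⟩ := Finset.mem_biUnion.1 hx
  rw [same_iff (hY hb) hxb, same_iff (π := π.restrict Y) (Finset.mem_inter.2 ⟨hY hb, hb⟩) hxb]

theorem biUnion_subset_support {π : NCPartition} {Y : Finset (Finset ℕ)} (hY : Y ⊆ π.blocks) :
    Y.biUnion id ⊆ π.support :=
  Finset.biUnion_subset_biUnion_of_subset_left _ hY

theorem mem_biUnion_iff_mem {π : NCPartition} {Y : Finset (Finset ℕ)} (hY : Y ⊆ π.blocks)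
    {b : Finset ℕ} (hb : b ∈ π.blocks) {x : ℕ} (hx : x ∈ b) : x ∈ Y.biUnion id ↔ b ∈ Y := by
  constructor
  · intro h
    obtain ⟨b', hb', hx'⟩ := Finset.mem_biUnion.1 h
    rwa [block_unique hb (hY hb') hx hx']
  · intro h
    exact Finset.mem_biUnion.2 ⟨b, h, hx⟩

theorem biUnion_sdiff {π : NCPartition} {J : Finset (Finset ℕ)} (hJ : J ⊆ π.blocks) :
    (π.blocks \ J).biUnion id = π.support \ J.biUnion id := by
  ext x
  rw [Finset.mem_sdiff]
  constructor
  · intro h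
    obtain ⟨b, hb, hx⟩ := Finset.mem_biUnion.1 h
    rw [Finset.mem_sdiff] at hb
    exact ⟨mem_support hb.1 hx, by rw [mem_biUnion_iff_mem hJ hb.1 hx]; exact hb.2⟩
  · rintro ⟨h1, h2⟩
    obtain ⟨b, hb, hx⟩ := mem_support_iff.1 h1
    rw [mem_biUnion_iff_mem hJ hb hx] at h2
    exact Finset.mem_biUnion.2 ⟨b, Finset.mem_sdiff.2 ⟨hb, h2⟩, hx⟩

/-- The definition of an ideal only supplies some set of blocks with union `C`; all the blocks
contained in `C` do as well, and this is the set used in `restrictProd`. -/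
theorem IsIdeal.biUnion_filter {π : NCPartition} {J : Finset (Finset ℕ)} (hJ : π.IsIdeal J)
    {C : Finset ℕ} (hC : C ∈ π.componentsOf J) :
    (π.blocks.filter (· ⊆ C)).biUnion id = C := by
  obtain ⟨Q, hQ, rfl⟩ := hJ.2 C hC
  ext x
  constructor
  · intro h
    obtain ⟨b, hb, hx⟩ := Finset.mem_biUnion.1 h
    exact (Finset.mem_filter.1 hb).2 hx
  · intro h
    obtain ⟨b, hb, hx⟩ := Finset.mem_biUnion.1 h
    refine Finset.mem_biUnion.2 ⟨b, Finset.mem_filter.2 ⟨hQ hb, fun y hy => ?_⟩, hx⟩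
    exact Finset.mem_biUnion.2 ⟨b, hb, hy⟩

/-- An element with colour at least `m` never separates two elements with colours below `m`, so the
low part can be tested by itself. An element with colour below `m` always separates two high ones,
so a level component of a high element stays inside its connected component in the union of `J`. -/
theorem IsIdeal.valid_iff {π : NCPartition} {J : Finset (Finset ℕ)} (hJ : π.IsIdeal J) {m : ℕ}
    {c : ℕ → ℕ} (hc : ∀ x ∈ π.support, m ≤ c x ↔ x ∈ J.biUnion id) :
    π.Valid c ↔ (π.restrict (π.blocks \ J)).Valid c ∧
      ∀ C ∈ π.componentsOf J, (π.restrict (π.blocks.filter (· ⊆ C))).Valid c := by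
  have hlow : ∀ x ∈ π.support \ J.biUnion id, ∀ y ∈ π.support \ J.biUnion id,
      ((π.restrict (π.blocks \ J)).Same x y ↔ π.Same x y) ∧
      (LevelRel (π.support \ J.biUnion id) c x y ↔ LevelRel π.support c x y) := by
    intro x hx y hy
    refine ⟨same_restrict Finset.sdiff_subset (by rwa [biUnion_sdiff hJ.1]), ?_⟩
    refine and_congr_right fun _ => ⟨fun h z hz h1 h2 => ?_, fun h z hz h1 h2 =>
      h z (Finset.mem_sdiff.1 hz).1 h1 h2⟩
    by_cases hzJ : z ∈ J.biUnion id
    · rw [Finset.mem_sdiff] at hx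
      have := (hc z hz).2 hzJ
      have := mt (hc x hx.1).1 hx.2
      omega
    · exact h z (Finset.mem_sdiff.2 ⟨hz, hzJ⟩) h1 h2
  have hup : ∀ C ∈ π.componentsOf J, ∀ x ∈ C, ∀ y ∈ C,
      ((π.restrict (π.blocks.filter (· ⊆ C))).Same x y ↔ π.Same x y) ∧
      (LevelRel C c x y ↔ LevelRel π.support c x y) := by
    intro C hC x hx y hy
    refine ⟨same_restrict (Finset.filter_subset _ _) (by rwa [hJ.biUnion_filter hC]), ?_⟩
    obtain ⟨hxJ, rfl⟩ := eq_component hC hx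
    refine and_congr_right fun _ => ⟨fun h z hz h1 h2 => ?_, fun h z hz h1 h2 =>
      h z (biUnion_subset_support hJ.1 (mem_component.1 hz).1) h1 h2⟩
    refine h z (mem_component.2 ⟨(mem_component.1 hy).2 z hz h1 h2, fun w hw h3 h4 =>
      (mem_component.1 hy).2 w hw ?_ ?_⟩) h1 h2 <;> omega
  constructor
  · intro h
    refine ⟨?_, fun C hC => ?_⟩
    · intro x hx y hy
      rw [support_restrict Finset.sdiff_subset, biUnion_sdiff hJ.1] at hx hy ⊢
      rw [(hlow x hx y hy).1, (hlow x hx y hy).2]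
      exact h x (Finset.mem_sdiff.1 hx).1 y (Finset.mem_sdiff.1 hy).1
    · intro x hx y hy
      rw [support_restrict (Finset.filter_subset _ _), hJ.biUnion_filter hC] at hx hy ⊢
      rw [(hup C hC x hx y hy).1, (hup C hC x hx y hy).2]
      have hCS : C ⊆ π.support := by
        rw [← hJ.biUnion_filter hC]
        exact biUnion_subset_support (Finset.filter_subset _ _)
      exact h x (hCS hx) y (hCS hy)
  · rintro ⟨h1, h2⟩ x hx y hy
    obtain ⟨b, hb, hxb⟩ := mem_support_iff.1 hx
    rw [same_iff hb hxb]
    by_cases hxJ : x ∈ J.biUnion id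
    · have hCx : component π.support (J.biUnion id) x ∈ π.componentsOf J :=
        Finset.mem_image_of_mem _ hxJ
      have hxC := self_mem_component (U := π.support) hxJ
      by_cases hyC : y ∈ component π.support (J.biUnion id) x
      · rw [← same_iff hb hxb, ← (hup _ hCx x hxC y hyC).1, ← (hup _ hCx x hxC y hyC).2]
        have := h2 _ hCx x
        rw [support_restrict (Finset.filter_subset _ _), hJ.biUnion_filter hCx] at this
        exact this hxC y hyC
      · refine iff_of_false (fun hyb => hyC ?_) (fun hl => hyC ?_)
        · obtain ⟨Q, hQ, hQC⟩ := hJ.2 _ hCx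
          rw [hQC] at hxC ⊢
          rw [mem_biUnion_iff_mem hQ hb hxb] at hxC
          exact Finset.mem_biUnion.2 ⟨b, hxC, hyb⟩
        · have hmx := (hc x hx).2 hxJ
          refine mem_component.2 ⟨(hc y hy).1 (hl.1 ▸ hmx), fun z hz h3 h4 => ?_⟩
          exact (hc z hz).1 (hmx.trans (hl.2 z hz h3 h4))
    · by_cases hyJ : y ∈ J.biUnion id
      · refine iff_of_false (fun hyb => hxJ ?_) (fun hl => hxJ ?_)
        · rw [mem_biUnion_iff_mem hJ.1 hb hyb] at hyJ
          exact Finset.mem_biUnion.2 ⟨b, hyJ, hxb⟩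
        · rw [← hc x hx, hl.1, hc y hy]
          exact hyJ
      · have hx' := Finset.mem_sdiff.2 ⟨hx, hxJ⟩
        have hy' := Finset.mem_sdiff.2 ⟨hy, hyJ⟩
        rw [← same_iff hb hxb, ← (hlow x hx' y hy').1, ← (hlow x hx' y hy').2]
        have := h1 x
        rw [support_restrict Finset.sdiff_subset, biUnion_sdiff hJ.1] at this
        exact this hx' y hy'

/-- The blocks of `π` with colours at least `m`. -/
def upper (π : NCPartition) (m : ℕ) (c : ℕ → ℕ) : Finset (Finset ℕ) :=
  π.blocks.filter fun b => ∀ x ∈ b, m ≤ c x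

theorem Valid.color_eq {π : NCPartition} {c : ℕ → ℕ} (h : π.Valid c) {x y : ℕ}
    (hxy : π.Same x y) : c x = c y := by
  obtain ⟨b, hb, hx, hy⟩ := hxy
  exact ((h x (mem_support hb hx) y (mem_support hb hy)).1 ⟨b, hb, hx, hy⟩).1

theorem Valid.mem_upper {π : NCPartition} {c : ℕ → ℕ} (h : π.Valid c) (m : ℕ) {x : ℕ}
    (hx : x ∈ π.support) : m ≤ c x ↔ x ∈ (π.upper m c).biUnion id := by
  obtain ⟨b, hb, hxb⟩ := mem_support_iff.1 hx
  rw [upper, mem_biUnion_iff_mem (Finset.filter_subset _ _) hb hxb, Finset.mem_filter]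
  constructor
  · intro hm
    exact ⟨hb, fun y hy => h.color_eq ⟨b, hb, hxb, hy⟩ ▸ hm⟩
  · intro hm
    exact hm.2 x hxb

/-- Between two elements of a block no colour is smaller than that of the block. A block coloured at
least `m` therefore lies in a single connected component of the upper set. -/
theorem Valid.isIdeal_upper {π : NCPartition} {c : ℕ → ℕ} (h : π.Valid c) (m : ℕ) :
    π.IsIdeal (π.upper m c) := by
  refine ⟨Finset.filter_subset _ _, fun C hC => ⟨π.blocks.filter (· ⊆ C),
    Finset.filter_subset _ _, ?_⟩⟩
  ext y
  constructor
  · intro hy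
    obtain ⟨hyJ, rfl⟩ := eq_component hC hy
    have hyS := biUnion_subset_support (Finset.filter_subset _ _) hyJ
    obtain ⟨b, hb, hyb⟩ := mem_support_iff.1 hyS
    refine Finset.mem_biUnion.2 ⟨b, Finset.mem_filter.2 ⟨hb, fun w hw => ?_⟩, hyb⟩
    have hl := (h y hyS w (mem_support hb hw)).1 ⟨b, hb, hyb, hw⟩
    have hmy := (h.mem_upper m hyS).2 hyJ
    refine mem_component.2 ⟨(h.mem_upper m (mem_support hb hw)).1 (hl.1 ▸ hmy), ?_⟩
    intro z hz h1 h2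
    exact (h.mem_upper m hz).1 (hmy.trans (hl.2 z hz h1 h2))
  · intro hy
    obtain ⟨b, hb, hyb⟩ := Finset.mem_biUnion.1 hy
    exact (Finset.mem_filter.1 hb).2 hyb

theorem card_colorings_Ico (π : NCPartition) (m n : ℕ) :
    (π.colorings (Finset.Ico m (m + n))).card = π.numColorings n := by
  have key : ∀ c d : ℕ → ℕ, (∀ x ∈ π.support, c x = m + d x) → (π.Valid c ↔ π.Valid d) := by
    intro c d h
    refine forall₂_congr fun x hx => forall₂_congr fun y hy => ?_
    refine iff_congr Iff.rfl ?_
    unfold LevelRel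
    rw [h x hx, h y hy, add_right_inj]
    refine and_congr_right fun _ => forall₂_congr fun z hz => ?_
    rw [h z hz, add_le_add_iff_left]
  refine Finset.card_nbij' (fun c x => c x - m)
    (fun d x => if x ∈ π.support then m + d x else 0) ?_ ?_ ?_ ?_
  · intro c hc
    simp only [Finset.mem_coe, mem_colorings, Finset.mem_Ico, Finset.mem_range] at hc ⊢
    refine ⟨fun x hx => ?_, fun x hx => ?_, (key _ _ fun x hx => ?_).1 hc.2.2⟩
    · have := hc.1 x hx; omega
    · have := hc.2.1 x hx; omega
    · have := hc.1 x hx; omega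
  · intro d hd
    simp only [Finset.mem_coe, mem_colorings, Finset.mem_Ico, Finset.mem_range] at hd ⊢
    refine ⟨fun x hx => ?_, fun x hx => ?_, (key _ _ fun x hx => ?_).2 hd.2.2⟩
    · have := hd.1 x hx; simp [hx]; omega
    · simp [hx]
    · simp [hx]
  · intro c hc
    simp only [Finset.mem_coe, mem_colorings, Finset.mem_Ico] at hc
    funext x
    by_cases hx : x ∈ π.support
    · have := hc.1 x hx; simp [hx]; omega
    · simp [hx, hc.2.1 x hx]
  · intro d hd
    simp only [Finset.mem_coe, mem_colorings] at hd
    funext x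
    by_cases hx : x ∈ π.support
    · simp [hx]
    · simp [hx, hd.2.1 x hx]

-- Colourings are fibred over the ideal of blocks with colours at least `m`. In the fibre of `J` the
-- two parts use the colours below `m` and those in `Ico m (m + n)`, and they vary independently;
-- shifting by `m` turns the latter into `n` colours.
open scoped Classical in
theorem numColorings_add (π : NCPartition) (m n : ℕ) :
    π.numColorings (m + n) = ∑ J ∈ π.blocks.powerset.filter π.IsIdeal,
      (π.restrict (π.blocks \ J)).numColorings m *
        ∏ C ∈ π.componentsOf J, (π.restrict (π.blocks.filter (· ⊆ C))).numColorings n := by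
  rw [numColorings, Finset.card_eq_sum_card_fiberwise (f := π.upper m)
    (t := π.blocks.powerset.filter π.IsIdeal)]
  swap
  · intro c hc
    have := (mem_colorings.1 hc).2.2.isIdeal_upper m
    simp [this, this.1]
  refine Finset.sum_congr rfl fun J hJ => ?_
  have hJ := (Finset.mem_filter.1 hJ).2
  simp only [← card_colorings_Ico _ m n]
  unfold colorings
  rw [← card_glue (π.componentsOf J) (fun C => (π.restrict (π.blocks.filter (· ⊆ C))).support) _ ?_
    (fun C => (π.restrict (π.blocks.filter (· ⊆ C))).Valid) (fun C _ => valid_local _)]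
  swap
  · intro C hC C' hC' h
    rw [support_restrict (Finset.filter_subset _ _), support_restrict (Finset.filter_subset _ _),
      hJ.biUnion_filter hC, hJ.biUnion_filter hC']
    exact components_disjoint hC hC' h
  have hV : (π.componentsOf J).biUnion
      (fun C => (π.restrict (π.blocks.filter (· ⊆ C))).support) = J.biUnion id := by
    rw [← biUnion_components π.support (J.biUnion id)]
    refine Finset.biUnion_congr rfl fun C hC => ?_
    rw [support_restrict (Finset.filter_subset _ _), hJ.biUnion_filter hC, id]
  rw [hV]
  have hsub := biUnion_subset_support hJ.1
  refine card_glue_pair ?_ (valid_local _) ?_ fun c => ?_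
  · rw [support_restrict Finset.sdiff_subset, biUnion_sdiff hJ.1]
    exact Finset.sdiff_disjoint
  · intro c c' h hc C hC
    refine valid_local _ c c' (fun x hx => h x ?_) (hc C hC)
    rw [← hV]
    exact Finset.mem_biUnion.2 ⟨C, hC, hx⟩
  · rw [support_restrict Finset.sdiff_subset, biUnion_sdiff hJ.1]
    simp only [Finset.mem_filter, mem_funs, Finset.mem_range, Finset.mem_Ico, Finset.mem_sdiff]
    constructor
    · rintro ⟨⟨⟨h1, h2⟩, h3⟩, h4⟩
      have hm : ∀ x ∈ π.support, m ≤ c x ↔ x ∈ J.biUnion id := by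
        rw [← h4]; exact fun x hx => h3.mem_upper m hx
      refine ⟨fun x hx => ?_, fun x hx => ⟨(hm x (hsub hx)).2 hx, h1 x (hsub hx)⟩,
        fun x hx hx' => h2 x fun h => hx ⟨h, hx'⟩, (hJ.valid_iff hm).1 h3⟩
      have := mt (hm x hx.1).1 hx.2
      omega
    · rintro ⟨h1, h2, h3, h4⟩
      have hm : ∀ x ∈ π.support, m ≤ c x ↔ x ∈ J.biUnion id := by
        intro x hx
        by_cases hxJ : x ∈ J.biUnion id
        · exact iff_of_true (h2 x hxJ).1 hxJ
        · have := h1 x ⟨hx, hxJ⟩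
          exact iff_of_false (by omega) hxJ
      refine ⟨⟨⟨fun x hx => ?_, fun x hx => h3 x (fun h => hx h.1) fun h => hx (hsub h)⟩,
        (hJ.valid_iff hm).2 h4⟩, ?_⟩
      · by_cases hxJ : x ∈ J.biUnion id
        · exact (h2 x hxJ).2
        · have := h1 x ⟨hx, hxJ⟩
          omega
      -- The glued colouring must lie in the fibre of `J`, not of another ideal: blocks are
      -- nonempty, so the colour of one element decides.
      · ext b
        rw [upper, Finset.mem_filter]
        constructor
        · rintro ⟨hb, hbm⟩
          obtain ⟨x, hx⟩ := π.nonempty_of_mem b hb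
          rw [← mem_biUnion_iff_mem hJ.1 hb hx]
          exact (hm x (mem_support hb hx)).1 (hbm x hx)
        · intro hb
          exact ⟨hJ.1 hb, fun x hx => (hm x (mem_support (hJ.1 hb) hx)).2
            (Finset.mem_biUnion.2 ⟨b, hb, hx⟩)⟩

end NCPartition
-- Lexicographic colourings, contractions and the coproduct δ
/-- The level relation of a lexicographic product of two colourings. -/
theorem levelRel_lex {S : Finset ℕ} {c c₁ c₂ : ℕ → ℕ} {n : ℕ}
    (hc : ∀ x ∈ S, c x = c₁ x * n + c₂ x) (h₂ : ∀ x ∈ S, c₂ x < n) {x y : ℕ} (hx : x ∈ S)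
    (hy : y ∈ S) {T : Finset ℕ} (hT : ∀ z, z ∈ T ↔ z ∈ S ∧ LevelRel S c₁ x z) :
    LevelRel S c x y ↔ LevelRel S c₁ x y ∧ LevelRel T c₂ x y := by
  have hdiv : ∀ z ∈ S, c z / n = c₁ z := fun z hz => by
    rw [hc z hz, mul_comm, Nat.mul_add_div (by have := h₂ z hz; omega),
      Nat.div_eq_of_lt (h₂ z hz), add_zero]
  have hmod : ∀ z ∈ S, c z % n = c₂ z := fun z hz => by
    rw [hc z hz, mul_comm, Nat.mul_add_mod, Nat.mod_eq_of_lt (h₂ z hz)]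
  constructor
  · rintro ⟨h, h'⟩
    refine ⟨⟨by rw [← hdiv x hx, ← hdiv y hy, h], fun z hz h1 h2 => ?_⟩,
      by rw [← hmod x hx, ← hmod y hy, h], fun z hz h1 h2 => ?_⟩
    · rw [← hdiv x hx, ← hdiv z hz]
      exact Nat.div_le_div_right (h' z hz h1 h2)
    · rw [hT] at hz
      have := h' z hz.1 h1 h2
      rw [hc x hx, hc z hz.1, hz.2.1] at this
      omega
  · rintro ⟨⟨h, h'⟩, h3, h4⟩
    refine ⟨by rw [hc x hx, hc y hy, h, h3], fun z hz h1 h2 => ?_⟩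
    -- If the first coordinates agree, `z` lies in the level component `T` and the second
    -- coordinates decide. Otherwise the first coordinate of `z` is larger, which contributes at
    -- least `n` and outweighs any second coordinate.
    rcases (h' z hz h1 h2).eq_or_lt with e | e
    · have hz' : z ∈ T := by
        rw [hT]
        exact ⟨hz, e, fun w hw h5 h6 => h' w hw (by omega) (by omega)⟩
      rw [hc x hx, hc z hz, e]
      have := h4 z hz' h1 h2
      omega
    · rw [hc x hx, hc z hz]
      have := Nat.mul_le_mul_right n (Nat.succ_le_of_lt e)
      have := h₂ x hx
      rw [Nat.succ_mul] at *
      omega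

namespace NCPartition

theorem support_quotient (π : NCPartition) (r : π.Contraction) :
    (π.quotient r).support = π.support := by
  ext x
  simp only [mem_support_iff, quotient, quotientBlocks, Finset.mem_image]
  constructor
  · rintro ⟨_, ⟨p, hp, rfl⟩, hx⟩
    obtain ⟨b, hb, hx⟩ := Finset.mem_biUnion.1 hx
    exact ⟨b, r.1.subset hp hb, hx⟩
  · rintro ⟨b, hb, hx⟩
    obtain ⟨p, hp, hbp⟩ := r.1.exists_mem hb
    exact ⟨_, ⟨p, hp, rfl⟩, Finset.mem_biUnion.2 ⟨b, hbp, hx⟩⟩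

theorem same_quotient {π : NCPartition} (r : π.Contraction) {x y : ℕ} :
    (π.quotient r).Same x y ↔ ∃ p ∈ r.1.parts, x ∈ p.biUnion id ∧ y ∈ p.biUnion id := by
  simp only [Same, quotient, quotientBlocks, Finset.mem_image]
  constructor
  · rintro ⟨_, ⟨p, hp, rfl⟩, h⟩
    exact ⟨p, hp, h⟩
  · rintro ⟨p, hp, h⟩
    exact ⟨_, ⟨p, hp, rfl⟩, h⟩

theorem biUnion_parts_unique {π : NCPartition} {r : Finpartition π.blocks}
    {p q : Finset (Finset ℕ)} (hp : p ∈ r.parts) (hq : q ∈ r.parts) {x : ℕ}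
    (hx : x ∈ p.biUnion id) (hx' : x ∈ q.biUnion id) : p = q := by
  obtain ⟨b, hb, hxb⟩ := Finset.mem_biUnion.1 hx
  rw [mem_biUnion_iff_mem (r.subset hq) (r.subset hp hb) hxb] at hx'
  exact r.eq_of_mem_parts hp hq hb hx'

theorem same_quotient_iff {π : NCPartition} (r : π.Contraction) {p : Finset (Finset ℕ)}
    (hp : p ∈ r.1.parts) {x y : ℕ} (hx : x ∈ p.biUnion id) :
    (π.quotient r).Same x y ↔ y ∈ p.biUnion id := by
  rw [same_quotient]
  constructor
  · rintro ⟨q, hq, h1, h2⟩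
    rwa [biUnion_parts_unique hp hq hx h1]
  · exact fun h => ⟨p, hp, hx, h⟩

/-- The classes of the contraction are the level components of `c₁`, so `levelRel_lex` applies with
`T` the union of a class: inside a class only `c₂` matters, and elements of different classes are
already separated by `c₁`. -/
theorem valid_lex_iff {π : NCPartition} (r : π.Contraction) {c c₁ c₂ : ℕ → ℕ} {n : ℕ}
    (hc : ∀ x ∈ π.support, c x = c₁ x * n + c₂ x) (h₂ : ∀ x ∈ π.support, c₂ x < n)
    (h₁ : (π.quotient r).Valid c₁) :
    π.Valid c ↔ ∀ p ∈ r.1.parts, (π.restrict p).Valid c₂ := by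
  unfold Valid at h₁
  rw [support_quotient] at h₁
  have hT : ∀ p ∈ r.1.parts, ∀ x ∈ p.biUnion id, ∀ z, z ∈ p.biUnion id ↔
      z ∈ π.support ∧ LevelRel π.support c₁ x z := by
    intro p hp x hx z
    rw [← same_quotient_iff r hp hx]
    have hsub := biUnion_subset_support (r.1.subset hp)
    constructor
    · intro h
      have hz := hsub ((same_quotient_iff r hp hx).1 h)
      exact ⟨hz, (h₁ x (hsub hx) z hz).1 h⟩
    · rintro ⟨h1, h2⟩
      exact (h₁ x (hsub hx) z h1).2 h2
  have key : ∀ p ∈ r.1.parts, ∀ x ∈ p.biUnion id, ∀ y ∈ p.biUnion id,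
      ((π.restrict p).Same x y ↔ π.Same x y) ∧
      (LevelRel (p.biUnion id) c₂ x y ↔ LevelRel π.support c x y) := by
    intro p hp x hx y hy
    have hsub := biUnion_subset_support (r.1.subset hp)
    refine ⟨same_restrict (r.1.subset hp) hx, ?_⟩
    rw [levelRel_lex hc h₂ (hsub hx) (hsub hy) (hT p hp x hx)]
    exact (and_iff_right ((hT p hp x hx y).1 hy).2).symm
  constructor
  · intro h p hp x hx y hy
    have hsub := biUnion_subset_support (r.1.subset hp)
    rw [support_restrict (r.1.subset hp)] at hx hy ⊢
    rw [(key p hp x hx y hy).1, (key p hp x hx y hy).2]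
    exact h x (hsub hx) y (hsub hy)
  · intro h x hx y hy
    obtain ⟨b, hb, hxb⟩ := mem_support_iff.1 hx
    obtain ⟨p, hp, hbp⟩ := r.1.exists_mem hb
    have hxp : x ∈ p.biUnion id := Finset.mem_biUnion.2 ⟨b, hbp, hxb⟩
    by_cases hyp : y ∈ p.biUnion id
    · have := h p hp x
      rw [support_restrict (r.1.subset hp)] at this
      rw [← (key p hp x hxp y hyp).1, ← (key p hp x hxp y hyp).2]
      exact this hxp y hyp
    · refine iff_of_false (fun hs => hyp ?_) (fun hl => hyp ?_)
      · rw [same_iff hb hxb] at hs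
        exact Finset.mem_biUnion.2 ⟨b, hbp, hs⟩
      · rw [levelRel_lex hc h₂ hx hy (hT p hp x hxp)] at hl
        exact (hT p hp x hxp y).2 ⟨hy, hl.1⟩

theorem bmin_mem {b : Finset ℕ} (hb : b.Nonempty) : bmin b ∈ b := by
  rw [bmin, dif_pos hb]; exact b.min'_mem hb

theorem bmax_mem {b : Finset ℕ} (hb : b.Nonempty) : bmax b ∈ b := by
  rw [bmax, dif_pos hb]; exact b.max'_mem hb

/-- Level components do not cross. -/
theorem isNoncrossing_of_levelRel {π : NCPartition} {P : Finset (Finset ℕ)} {c : ℕ → ℕ}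
    (hP : ∀ b ∈ P, b ⊆ π.support)
    (h : ∀ b ∈ P, ∀ x ∈ b, ∀ b' ∈ P, ∀ y ∈ b', b = b' ↔ LevelRel π.support c x y) :
    IsNoncrossing P := by
  rintro b hb b' hb' hne x hx z hz y hy t ht ⟨h1, h2, h3⟩
  have hxz := (h b hb x hx b hb z hz).1 rfl
  have hyt := (h b' hb' y hy b' hb' t ht).1 rfl
  -- A crossing x < y < z < t forces c x ≤ c y ≤ c z = c x, which puts x and y in the same level
  -- component.
  have e1 := hxz.2 y (hP b' hb' hy) (by omega) (by omega)
  have e2 := hyt.2 z (hP b hb hz) (by omega) (by omega)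
  have e3 := hxz.1
  refine hne ((h b hb x hx b' hb' y hy).2 ⟨by omega, fun w hw h4 h5 => ?_⟩)
  exact hxz.2 w hw (by omega) (by omega)

-- The hypothesis makes every level component of `c` a union of blocks. Grouping the blocks by level
-- component gives the contraction, which is noncrossing since level components never cross.
open scoped Classical in
theorem exists_contraction {π : NCPartition} {c : ℕ → ℕ}
    (h : ∀ b ∈ π.blocks, ∀ x ∈ b, ∀ y ∈ b, LevelRel π.support c x y) :
    ∃ r : π.Contraction, (π.quotient r).Valid c := by
  let k : Finset ℕ → Finset ℕ := fun b => π.support.filter (LevelRel π.support c (bmin b))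
  have hk : ∀ b ∈ π.blocks, ∀ x ∈ b, ∀ b' ∈ π.blocks, ∀ y ∈ b',
      k b = k b' ↔ LevelRel π.support c x y := by
    intro b hb x hx b' hb' y hy
    have hbx := h b hb _ (bmin_mem (π.nonempty_of_mem b hb)) x hx
    have hby := h b' hb' _ (bmin_mem (π.nonempty_of_mem b' hb')) y hy
    constructor
    · intro e
      have : x ∈ k b := Finset.mem_filter.2 ⟨mem_support hb hx, hbx⟩
      rw [e] at this
      exact ((Finset.mem_filter.1 this).2.symm.trans hby)
    · intro hl
      ext w
      simp only [k, Finset.mem_filter]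
      refine and_congr_right fun _ => ⟨fun h' => ?_, fun h' => ?_⟩
      · exact hby.trans (hl.symm.trans (hbx.symm.trans h'))
      · exact hbx.trans (hl.trans (hby.symm.trans h'))
  let r : Finpartition π.blocks := Finpartition.ofSetSetoid (Setoid.ker k) π.blocks
  have hr : ∀ p ∈ r.parts, ∀ x ∈ p.biUnion id, ∀ q ∈ r.parts, ∀ y ∈ q.biUnion id,
      p.biUnion id = q.biUnion id ↔ LevelRel π.support c x y := by
    intro p hp x hx q hq y hy
    obtain ⟨b, hb, hxb⟩ := Finset.mem_biUnion.1 hx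
    obtain ⟨b', hb', hyb⟩ := Finset.mem_biUnion.1 hy
    have hbm := r.subset hp hb
    have hbm' := r.subset hq hb'
    rw [← hk b hbm x hxb b' hbm' y hyb]
    have hpq : p.biUnion id = q.biUnion id ↔ p = q :=
      ⟨fun e => biUnion_parts_unique hp hq hx (e ▸ hx), fun e => e ▸ rfl⟩
    have h1 : r.part b = p := (r.part_eq_iff_mem hp).2 hb
    have h2 : r.part b' = q := (r.part_eq_iff_mem hq).2 hb'
    rw [hpq, ← h1, ← h2]
    have h3 : b' ∈ r.part b ↔ k b = k b' := by
      rw [Finpartition.mem_part_ofSetSetoid_iff_rel]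
      exact ⟨fun h => h.2.2, fun h => ⟨hbm, hbm', h⟩⟩
    rw [← h3, h1, h2]
    exact ⟨fun e => e ▸ hb', fun e => r.eq_of_mem_parts hp hq e hb'⟩
  have hnc : IsNoncrossing (π.quotientBlocks r) := by
    apply isNoncrossing_of_levelRel (π := π) (c := c)
    · intro b hb
      obtain ⟨p, hp, rfl⟩ := Finset.mem_image.1 hb
      exact biUnion_subset_support (r.subset hp)
    · intro b hb x hx b' hb' y hy
      obtain ⟨p, hp, rfl⟩ := Finset.mem_image.1 hb
      obtain ⟨q, hq, rfl⟩ := Finset.mem_image.1 hb'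
      exact hr p hp x hx q hq y hy
  obtain ⟨R, hR⟩ : ∃ R : π.Contraction, R.1 = r := ⟨⟨r, hnc⟩, rfl⟩
  rw [← hR] at hr
  refine ⟨R, fun x hx y hy => ?_⟩
  obtain ⟨B, hB, hxB⟩ := mem_support_iff.1 hx
  obtain ⟨B', hB', hyB⟩ := mem_support_iff.1 hy
  rw [same_iff hB hxB, support_quotient]
  obtain ⟨p, hp, rfl⟩ := Finset.mem_image.1 hB
  obtain ⟨q, hq, rfl⟩ := Finset.mem_image.1 hB'
  rw [← hr p hp x hxB q hq y hyB]
  exact ⟨fun h => block_unique hB hB' h hyB, fun h => h ▸ hyB⟩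

theorem contraction_unique {π : NCPartition} {c : ℕ → ℕ} {r r' : π.Contraction}
    (h : (π.quotient r).Valid c) (h' : (π.quotient r').Valid c) : r = r' := by
  have main : ∀ r r' : π.Contraction, (π.quotient r).Valid c → (π.quotient r').Valid c →
      r.1.parts ⊆ r'.1.parts := by
    intro r r' h h' p hp
    unfold Valid at h h'
    rw [support_quotient] at h h'
    obtain ⟨b, hb⟩ := r.1.nonempty_of_mem_parts hp
    have hbm := r.1.subset hp hb
    obtain ⟨x, hx⟩ := π.nonempty_of_mem b hbm
    obtain ⟨q, hq, hbq⟩ := r'.1.exists_mem hbm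
    have hxp : x ∈ p.biUnion id := Finset.mem_biUnion.2 ⟨b, hb, hx⟩
    have hxq : x ∈ q.biUnion id := Finset.mem_biUnion.2 ⟨b, hbq, hx⟩
    have hxS := mem_support hbm hx
    have : p = q := by
      ext b'
      by_cases hb' : b' ∈ π.blocks
      · obtain ⟨y, hy⟩ := π.nonempty_of_mem b' hb'
        have hyS := mem_support hb' hy
        rw [← mem_biUnion_iff_mem (r.1.subset hp) hb' hy, ← same_quotient_iff r hp hxp,
          ← mem_biUnion_iff_mem (r'.1.subset hq) hb' hy, ← same_quotient_iff r' hq hxq,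
          h x hxS y hyS, h' x hxS y hyS]
      · exact iff_of_false (fun e => hb' (r.1.subset hp e)) fun e => hb' (r'.1.subset hq e)
    rwa [this]
  exact Subtype.ext (Finpartition.ext ((main r r' h h').antisymm (main r' r h' h)))

open scoped Classical in
theorem card_filter_quotient (π : NCPartition) (r : π.Contraction) (m n : ℕ) :
    ((π.colorings (Finset.range (m * n))).filter
        fun c => (π.quotient r).Valid fun x => c x / n).card =
      (π.quotient r).numColorings m * ∏ p ∈ r.1.parts, (π.restrict p).numColorings n := by
  have hsup : r.1.parts.biUnion (fun p => (π.restrict p).support) = π.support := by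
    ext x
    rw [← support_quotient π r, mem_support_iff]
    simp only [Finset.mem_biUnion, quotient, quotientBlocks, Finset.mem_image]
    constructor
    · rintro ⟨p, hp, hx⟩
      rw [support_restrict (r.1.subset hp)] at hx
      exact ⟨_, ⟨p, hp, rfl⟩, hx⟩
    · rintro ⟨_, ⟨p, hp, rfl⟩, hx⟩
      exact ⟨p, hp, by rwa [support_restrict (r.1.subset hp)]⟩
  unfold numColorings colorings
  rw [← card_glue r.1.parts (fun p => (π.restrict p).support) _ ?_
    (fun p => (π.restrict p).Valid) (fun p _ => valid_local _), hsup, ← Finset.card_product]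
  swap
  · intro p hp q hq hne
    rw [support_restrict (r.1.subset hp), support_restrict (r.1.subset hq), Finset.disjoint_left]
    exact fun x hx hx' => hne (biUnion_parts_unique hp hq hx hx')
  have hloc := valid_local (π.quotient r)
  rw [support_quotient] at hloc ⊢
  refine Finset.card_nbij' (fun c => (fun x => c x / n, fun x => c x % n))
    (fun p x => p.1 x * n + p.2 x) ?_ ?_ ?_ ?_
  · intro c hc
    simp only [Finset.coe_filter, Set.mem_ofPred_eq, Finset.mem_filter, mem_funs,
      Finset.mem_range, Finset.coe_product, Set.mem_prod] at hc ⊢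
    obtain ⟨⟨⟨h1, h2⟩, h3⟩, h4⟩ := hc
    -- For `n = 0` there are no colours, so a colouring exists only on an empty support.
    have hn : ∀ x ∈ π.support, 0 < n := fun x hx =>
      Nat.pos_of_ne_zero fun h => by have := h1 x hx; simp [h] at this
    have hmod : ∀ x ∈ π.support, c x % n < n := fun x hx => Nat.mod_lt _ (hn x hx)
    refine ⟨⟨⟨fun x hx => Nat.div_lt_of_lt_mul (by rw [mul_comm]; exact h1 x hx),
      fun x hx => by simp [h2 x hx]⟩, h4⟩, ⟨hmod, fun x hx => by simp [h2 x hx]⟩, ?_⟩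
    exact (valid_lex_iff r (fun x _ => (Nat.div_add_mod' _ _).symm) hmod h4).1 h3
  · rintro ⟨c, d⟩ hc
    simp only [Finset.coe_filter, Set.mem_ofPred_eq, Finset.mem_filter, mem_funs,
      Finset.mem_range, Finset.coe_product, Set.mem_prod] at hc ⊢
    obtain ⟨⟨⟨h1, h2⟩, h3⟩, ⟨h4, h5⟩, h6⟩ := hc
    have hdiv : ∀ z ∈ π.support, c z = (c z * n + d z) / n := fun z hz => by
      rw [mul_comm, Nat.mul_add_div (by have := h4 z hz; omega),
        Nat.div_eq_of_lt (h4 z hz), add_zero]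
    refine ⟨⟨⟨fun x hx => ?_, fun x hx => by simp [h2 x hx, h5 x hx]⟩,
      (valid_lex_iff r (fun x _ => rfl) h4 h3).2 h6⟩, hloc _ _ hdiv h3⟩
    have e1 := Nat.mul_le_mul_right n (Nat.succ_le_of_lt (h1 x hx))
    have e2 := h4 x hx
    rw [Nat.succ_mul] at e1
    omega
  · intro c _
    funext x
    exact Nat.div_add_mod' _ _
  · rintro ⟨c, d⟩ hc
    simp only [Finset.coe_filter, Set.mem_ofPred_eq, mem_funs,
      Finset.mem_range, Finset.coe_product, Set.mem_prod] at hc ⊢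
    obtain ⟨⟨⟨h1, h2⟩, h3⟩, ⟨h4, h5⟩, h6⟩ := hc
    ext x
    · by_cases hx : x ∈ π.support
      · simp only
        rw [mul_comm, Nat.mul_add_div (by have := h4 x hx; omega),
          Nat.div_eq_of_lt (h4 x hx), add_zero]
      · simp [h2 x hx, h5 x hx]
    · by_cases hx : x ∈ π.support
      · simp only
        rw [mul_comm, Nat.mul_add_mod, Nat.mod_eq_of_lt (h4 x hx)]
      · simp [h2 x hx, h5 x hx]

/-- Division by `n` is monotone, so each block stays inside one level component of `c / n`. Hence `c
/ n` is valid on exactly one contraction, and the colourings are sorted by it. -/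
theorem numColorings_mul (π : NCPartition) (m n : ℕ) :
    π.numColorings (m * n) = ∑ r : π.Contraction,
      (π.quotient r).numColorings m * ∏ p ∈ r.1.parts, (π.restrict p).numColorings n := by
  classical
  simp only [← card_filter_quotient]
  rw [← Finset.card_biUnion, numColorings]
  · congr 1
    ext c
    simp only [Finset.mem_biUnion, Finset.mem_univ, true_and, Finset.mem_filter]
    refine ⟨fun hc => ?_, fun ⟨_, h, _⟩ => h⟩
    obtain ⟨r, hr⟩ := exists_contraction (π := π) (c := fun x => c x / n)
      fun b hb x hx y hy => by
        have hl := ((mem_colorings.1 hc).2.2 x (mem_support hb hx) y (mem_support hb hy)).1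
          ⟨b, hb, hx, hy⟩
        exact ⟨by simp only [hl.1], fun z hz h1 h2 => Nat.div_le_div_right (hl.2 z hz h1 h2)⟩
    exact ⟨r, hc, hr⟩
  · intro r _ r' _ hne
    rw [Function.onFun, Finset.disjoint_left]
    intro c hc hc'
    exact hne (contraction_unique (Finset.mem_filter.1 hc).2 (Finset.mem_filter.1 hc').2)

/-! ### Colourings as functions on blocks, and the colouring polynomial -/

/-- Valid colourings, as functions on blocks. -/
def ValidOnBlocks (π : NCPartition) (f : π.blocks → ℕ) : Prop :=
  ∀ b b' : π.blocks, ∀ x ∈ b.1, ∀ y ∈ b'.1,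
    b = b' ↔ f b = f b' ∧ ∀ d : π.blocks, ∀ z ∈ d.1, min x y ≤ z → z ≤ max x y → f b ≤ f d

theorem ValidOnBlocks.of_le_iff_le {π : NCPartition} {f g : π.blocks → ℕ}
    (h : ∀ a b, f a ≤ f b ↔ g a ≤ g b) (hf : π.ValidOnBlocks f) : π.ValidOnBlocks g := by
  have h' : ∀ a b, f a = f b ↔ g a = g b := fun a b => by
    rw [le_antisymm_iff, h, h, ← le_antisymm_iff]
  intro b b' x hx y hy
  rw [hf b b' x hx y hy, h']
  simp only [h]

theorem valid_iff_validOnBlocks {π : NCPartition} {c : ℕ → ℕ} {f : π.blocks → ℕ}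
    (h : ∀ b : π.blocks, ∀ x ∈ b.1, c x = f b) : π.Valid c ↔ π.ValidOnBlocks f := by
  have key : ∀ b b' : π.blocks, ∀ x ∈ b.1, ∀ y ∈ b'.1,
      (π.Same x y ↔ LevelRel π.support c x y) ↔ (b = b' ↔ f b = f b' ∧
        ∀ d : π.blocks, ∀ z ∈ d.1, min x y ≤ z → z ≤ max x y → f b ≤ f d) := by
    intro b b' x hx y hy
    refine iff_congr ?_ ?_
    · rw [same_iff b.2 hx]
      exact ⟨fun e => Subtype.ext (block_unique b.2 b'.2 e hy), fun e => e ▸ hy⟩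
    · unfold LevelRel
      rw [h b x hx, h b' y hy]
      refine and_congr_right fun _ => ⟨fun e d z hz h1 h2 => ?_, fun e z hz h1 h2 => ?_⟩
      · rw [← h d z hz]
        exact e z (mem_support d.2 hz) h1 h2
      · obtain ⟨d, hd, hzd⟩ := mem_support_iff.1 hz
        rw [h ⟨d, hd⟩ z hzd]
        exact e ⟨d, hd⟩ z hzd h1 h2
  constructor
  · intro hv b b' x hx y hy
    exact (key b b' x hx y hy).1 (hv x (mem_support b.2 hx) y (mem_support b'.2 hy))
  · intro hv x hx y hy
    obtain ⟨b, hb, hxb⟩ := mem_support_iff.1 hx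
    obtain ⟨b', hb', hyb⟩ := mem_support_iff.1 hy
    exact (key ⟨b, hb⟩ ⟨b', hb'⟩ x hxb y hyb).2 (hv _ _ x hxb y hyb)

open scoped Classical in
theorem numColorings_eq_card_blocks (π : NCPartition) (n : ℕ) :
    π.numColorings n =
      (Finset.univ.filter fun f : π.blocks → Fin n => π.ValidOnBlocks fun b => f b).card := by
  let ext : (π.blocks → Fin n) → ℕ → ℕ :=
    fun f x => if h : ∃ b : π.blocks, x ∈ b.1 then (f h.choose : ℕ) else 0
  have hext : ∀ f, ∀ b : π.blocks, ∀ x ∈ b.1, ext f x = f b := by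
    intro f b x hx
    have h : ∃ b : π.blocks, x ∈ b.1 := ⟨b, hx⟩
    have : h.choose = b := Subtype.ext (block_unique h.choose.2 b.2 h.choose_spec hx)
    simp only [ext, dif_pos h, this]
  have hext0 : ∀ f, ∀ x ∉ π.support, ext f x = 0 := by
    intro f x hx
    refine dif_neg fun ⟨b, hb⟩ => hx (mem_support b.2 hb)
  symm
  refine Finset.card_nbij ext ?_ ?_ ?_
  · intro f hf
    simp only [Finset.coe_filter, Finset.mem_univ, true_and, Set.mem_ofPred_eq] at hf
    simp only [Finset.mem_coe, mem_colorings, Finset.mem_range]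
    refine ⟨fun x hx => ?_, hext0 f, (valid_iff_validOnBlocks (hext f)).2 hf⟩
    obtain ⟨b, hb, hxb⟩ := mem_support_iff.1 hx
    rw [hext f ⟨b, hb⟩ x hxb]
    exact (f _).2
  · intro f _ g _ h
    funext b
    have hb := bmin_mem (π.nonempty_of_mem b.1 b.2)
    apply Fin.ext
    rw [← hext f b _ hb, ← hext g b _ hb, h]
  · intro c hc
    simp only [Finset.mem_coe, mem_colorings, Finset.mem_range] at hc
    let f : π.blocks → Fin n := fun b =>
      ⟨c (bmin b.1), hc.1 _ (mem_support b.2 (bmin_mem (π.nonempty_of_mem b.1 b.2)))⟩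
    have hf : ∀ b : π.blocks, ∀ x ∈ b.1, c x = f b := fun b x hx =>
      hc.2.2.color_eq ⟨b.1, b.2, hx, bmin_mem (π.nonempty_of_mem b.1 b.2)⟩
    refine ⟨f, ?_, ?_⟩
    · simp only [Finset.coe_filter, Finset.mem_univ, true_and, Set.mem_ofPred_eq]
      exact (valid_iff_validOnBlocks hf).1 hc.2.2
    · funext x
      by_cases hx : x ∈ π.support
      · obtain ⟨b, hb, hxb⟩ := mem_support_iff.1 hx
        rw [hext f ⟨b, hb⟩ x hxb, hf ⟨b, hb⟩ x hxb]
      · rw [hext0 f x hx, hc.2.1 x hx]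

end NCPartition

open scoped Classical in
/-- Counting functions by their image, for a property that depends only on the relative order of
the values. -/
theorem card_filter_eq_sum_choose {B : Type*} [Fintype B] [DecidableEq B] (V : (B → ℕ) → Prop)
    (hV : ∀ f g : B → ℕ, (∀ a b, f a ≤ f b ↔ g a ≤ g b) → V f → V g) (n : ℕ) :
    (Finset.univ.filter fun f : B → Fin n => V fun b => f b).card =
      ∑ k ∈ Finset.range (Fintype.card B + 1), n.choose k *
        (Finset.univ.filter fun f : B → Fin k => Function.Surjective f ∧ V fun b => f b).card := by
  set a : ℕ → ℕ := fun k => (Finset.univ.filter fun f : B → Fin k =>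
    Function.Surjective f ∧ V fun b => f b).card with ha
  -- Functions with image `s` are surjections onto `Fin s.card` followed by the increasing
  -- enumeration of `s`, which preserves the relative order of values.
  have hfib : ∀ s : Finset (Fin n), ((Finset.univ.filter fun f : B → Fin n => V fun b => f b).filter
      fun f => Finset.univ.image f = s).card = a s.card := by
    intro s
    symm
    refine Finset.card_nbij (fun g b => s.orderEmbOfFin rfl (g b)) ?_ ?_ ?_
    · intro g hg
      simp only [Finset.coe_filter, Finset.mem_univ, true_and, Set.mem_ofPred_eq,
        Finset.mem_filter] at hg ⊢
      refine ⟨hV _ _ (fun x y => ?_) hg.2, ?_⟩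
      · simp
      · ext i
        rw [← Finset.mem_coe (s := s), ← Finset.range_orderEmbOfFin s rfl]
        simp only [Finset.mem_image, Finset.mem_univ, true_and, Set.mem_range]
        constructor
        · rintro ⟨b, rfl⟩
          exact ⟨_, rfl⟩
        · rintro ⟨j, rfl⟩
          obtain ⟨b, rfl⟩ := hg.1 j
          exact ⟨b, rfl⟩
    · intro g _ g' _ h
      funext b
      exact (s.orderEmbOfFin rfl).injective (congrFun h b)
    · intro f hf
      simp only [Finset.coe_filter, Finset.mem_univ, true_and, Set.mem_ofPred_eq,
        Finset.mem_filter] at hf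
      obtain ⟨hf1, hf2⟩ := hf
      have hmem : ∀ b, ∃ j, s.orderEmbOfFin rfl j = f b := by
        intro b
        have : f b ∈ (s : Set (Fin n)) := by
          rw [Finset.mem_coe, ← hf2]; exact Finset.mem_image_of_mem _ (Finset.mem_univ _)
        rwa [← Finset.range_orderEmbOfFin s rfl] at this
      choose g hg using hmem
      refine ⟨g, ?_, funext hg⟩
      simp only [Finset.coe_filter, Finset.mem_univ, true_and, Set.mem_ofPred_eq]
      refine ⟨fun j => ?_, hV _ _ (fun x y => ?_) hf1⟩
      · have : s.orderEmbOfFin rfl j ∈ Finset.univ.image f := by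
          rw [hf2]; exact Finset.orderEmbOfFin_mem s rfl j
        obtain ⟨b, _, hb⟩ := Finset.mem_image.1 this
        refine ⟨b, (s.orderEmbOfFin rfl).injective ?_⟩
        rw [hg, hb]
      · rw [← hg x, ← hg y]
        simp
  have hzero : ∀ k, Fintype.card B < k → a k = 0 := by
    intro k hk
    rw [ha]
    simp only [Finset.card_eq_zero, Finset.filter_eq_empty_iff]
    rintro f _ ⟨hf, _⟩
    have := Fintype.card_le_of_surjective f hf
    simp at this
    omega
  rw [Finset.card_eq_sum_card_fiberwise (f := fun f : B → Fin n => Finset.univ.image f)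
    (t := Finset.univ.powerset) (fun _ _ => by simp)]
  simp only [hfib]
  rw [Finset.sum_powerset_apply_card]
  simp only [Finset.card_univ, Fintype.card_fin, smul_eq_mul]
  -- Both sums extend to a common range: the binomial coefficient vanishes for `k > n`, and no
  -- surjection exists for `k > Fintype.card B`.
  have e1 : ∑ k ∈ Finset.range (n + 1), n.choose k * a k =
      ∑ k ∈ Finset.range (max n (Fintype.card B) + 1), n.choose k * a k := by
    refine Finset.sum_subset (fun k => by simp; omega) fun k _ hk => ?_
    rw [Nat.choose_eq_zero_of_lt (by simpa using hk), zero_mul]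
  have e2 : ∑ k ∈ Finset.range (Fintype.card B + 1), n.choose k * a k =
      ∑ k ∈ Finset.range (max n (Fintype.card B) + 1), n.choose k * a k := by
    refine Finset.sum_subset (fun k => by simp; omega) fun k _ hk => ?_
    rw [hzero k (by simpa using hk), mul_zero]
  rw [e1, e2]

namespace NCPartition

open scoped Classical in
/-- The number of valid colourings of `π` using exactly `k` colours. -/
noncomputable def numSurj (π : NCPartition) (k : ℕ) : ℕ :=
  (Finset.univ.filter fun f : π.blocks → Fin k =>
    Function.Surjective f ∧ π.ValidOnBlocks fun b => f b).card

theorem numColorings_eq_sum (π : NCPartition) (n : ℕ) :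
    π.numColorings n = ∑ k ∈ Finset.range (π.blocks.card + 1), n.choose k * π.numSurj k := by
  rw [numColorings_eq_card_blocks, card_filter_eq_sum_choose π.ValidOnBlocks
    (fun _ _ => ValidOnBlocks.of_le_iff_le), Fintype.card_coe]
  rfl

theorem numColorings_of_blocks_eq_empty {π : NCPartition} (h : ¬ π.blocks.Nonempty) (n : ℕ) :
    π.numColorings n = 1 := by
  classical
  rw [Finset.not_nonempty_iff_eq_empty] at h
  have : IsEmpty π.blocks := by rw [h]; infer_instance
  rw [numColorings_eq_card_blocks]
  simp [ValidOnBlocks]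

theorem numColorings_zero {π : NCPartition} (h : π.blocks.Nonempty) : π.numColorings 0 = 0 := by
  classical
  have : Nonempty π.blocks := h.to_subtype
  rw [numColorings_eq_card_blocks]
  simp

/-- A constant colouring has a single level component, so it is valid exactly when there is one
block. This is the counit of δ. -/
theorem numColorings_one {π : NCPartition} (h : π.blocks.Nonempty) :
    π.numColorings 1 = if π.blocks.card = 1 then 1 else 0 := by
  classical
  rw [numColorings_eq_card_blocks]
  have key : ∀ f : π.blocks → Fin 1, π.ValidOnBlocks (fun b => f b) ↔ π.blocks.card = 1 := by
    intro f
    have : π.ValidOnBlocks (fun b => f b) ↔ ∀ b b' : π.blocks, b = b' := by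
      constructor
      · intro hv b b'
        exact (hv b b' _ (bmin_mem (π.nonempty_of_mem b.1 b.2)) _
          (bmin_mem (π.nonempty_of_mem b'.1 b'.2))).2 (by simp)
      · intro hv b b' x _ y _
        simp [hv b b']
    rw [this, Finset.card_eq_one]
    constructor
    · intro hv
      obtain ⟨b, hb⟩ := h
      refine ⟨b, ?_⟩
      ext b'
      rw [Finset.mem_singleton]
      exact ⟨fun hb' => congrArg Subtype.val (hv ⟨b', hb'⟩ ⟨b, hb⟩), fun e => e ▸ hb⟩
    · rintro ⟨b, hb⟩ ⟨x, hx⟩ ⟨y, hy⟩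
      rw [hb, Finset.mem_singleton] at hx hy
      exact Subtype.ext (hx.trans hy.symm)
  simp only [key]
  split_ifs with h1 <;> simp [h1]

variable (K : Type*) [Field K]

/-- The polynomial counting the valid colourings of `π`. -/
noncomputable def colorPoly (π : NCPartition) : Polynomial K :=
  ∑ k ∈ Finset.range (π.blocks.card + 1),
    Polynomial.C ((π.numSurj k : K) / (k.factorial : K)) * descPochhammer K k

/-- `descPochhammer K k` divided by `k!` takes the value `n.choose k` at `n`; characteristic zero
permits the division. -/
theorem eval_colorPoly [CharZero K] (π : NCPartition) (n : ℕ) :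
    (π.colorPoly K).eval (n : K) = π.numColorings n := by
  rw [colorPoly, Polynomial.eval_finsetSum, numColorings_eq_sum, Nat.cast_sum]
  refine Finset.sum_congr rfl fun k _ => ?_
  rw [Polynomial.eval_mul, Polynomial.eval_C, descPochhammer_eval_eq_descFactorial,
    Nat.descFactorial_eq_factorial_mul_choose]
  have : (k.factorial : K) ≠ 0 := Nat.cast_ne_zero.2 k.factorial_ne_zero
  push_cast
  field_simp

end NCPartition

/-! ### The colouring morphism and the uniqueness of φ -/

section Algebra

variable (K : Type*) [Field K]

/-- Evaluation of both tensor factors at natural numbers. -/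
noncomputable def evalPair (m n : ℕ) : Polynomial K ⊗[K] Polynomial K →ₐ[K] K :=
  Algebra.TensorProduct.lift (Polynomial.aeval (m : K)) (Polynomial.aeval (n : K))
    fun _ _ => Commute.all _ _

theorem evalPair_tmul (m n : ℕ) (p q : Polynomial K) :
    evalPair K m n (p ⊗ₜ q) = p.eval (m : K) * q.eval (n : K) := by
  simp [evalPair, Polynomial.coe_aeval_eq_eval]

variable {K} in
theorem polynomial_ext_nat [CharZero K] {p q : Polynomial K}
    (h : ∀ n : ℕ, p.eval (n : K) = q.eval (n : K)) : p = q :=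
  Polynomial.eq_of_infinite_eval_eq p q
    ((Set.infinite_range_of_injective (Nat.cast_injective (R := K))).mono
      (by rintro _ ⟨n, rfl⟩; exact h n))

-- Under the identification of the tensor square with polynomials over `K[X]`, a polynomial is
-- determined by its values at the infinitely many constants `n`, and each value, in `K[X]`, by its
-- own values at the numbers `m`.
variable {K} in
theorem tensor_ext_evalPair [CharZero K] {s t : Polynomial K ⊗[K] Polynomial K}
    (h : ∀ m n : ℕ, evalPair K m n s = evalPair K m n t) : s = t := by
  have key : ∀ (m n : ℕ) (t : Polynomial K ⊗[K] Polynomial K),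
      (((polyEquivTensor K (Polynomial K)).symm t).eval (n : Polynomial K)).eval (m : K)
        = evalPair K m n t := by
    intro m n t
    induction t using TensorProduct.induction_on with
    | zero => simp
    | tmul p q =>
      rw [polyEquivTensor_symm_apply_tmul_eq_smul, evalPair_tmul, Polynomial.eval_smul,
        smul_eq_mul, Polynomial.eval_mul, Polynomial.eval_natCast_map]
      simp
    | add s t hs ht => simp [hs, ht]
  apply (polyEquivTensor K (Polynomial K)).symm.injective
  refine Polynomial.eq_of_infinite_eval_eq _ _
    ((Set.infinite_range_of_injective (Nat.cast_injective (R := Polynomial K))).mono ?_)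
  rintro _ ⟨n, rfl⟩
  refine polynomial_ext_nat fun m => ?_
  rw [key, key, h]

theorem evalPair_polyDelta1 (m n : ℕ) (p : Polynomial K) :
    evalPair K m n (polyDelta1 K p) = p.eval ((m + n : ℕ) : K) := by
  have : (evalPair K m n).comp (polyDelta1 K) = Polynomial.aeval ((m + n : ℕ) : K) := by
    apply Polynomial.algHom_ext
    simp [polyDelta1, evalPair_tmul]
  simpa [Polynomial.coe_aeval_eq_eval] using DFunLike.congr_fun this p

theorem evalPair_polyDelta2 (m n : ℕ) (p : Polynomial K) :
    evalPair K m n (polyDelta2 K p) = p.eval ((m * n : ℕ) : K) := by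
  have : (evalPair K m n).comp (polyDelta2 K) = Polynomial.aeval ((m * n : ℕ) : K) := by
    apply Polynomial.algHom_ext
    simp [polyDelta2, evalPair_tmul]
  simpa [Polynomial.coe_aeval_eq_eval] using DFunLike.congr_fun this p

/-- The morphism sending a noncrossing partition to its colouring polynomial. -/
noncomputable def colorHom : NCAlg K →ₐ[K] Polynomial K :=
  MvPolynomial.aeval fun π : NCP => π.toNCPartition.colorPoly K

theorem colorHom_X (π : NCP) : colorHom K (MvPolynomial.X π) = π.toNCPartition.colorPoly K := by
  simp [colorHom]

theorem eval_colorHom_gen [CharZero K] (π : NCPartition) (n : ℕ) :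
    (colorHom K (gen K π)).eval (n : K) = π.numColorings n := by
  unfold gen
  split_ifs with h
  · rw [colorHom_X, NCPartition.eval_colorPoly, ← π.numColorings_relabel]
    rfl
  · rw [NCPartition.numColorings_of_blocks_eq_empty h]
    simp

/-- It suffices to check generators, after evaluating both tensor factors at naturals `m` and `n`.
There `polyDelta1` becomes evaluation at `m + n` and `polyDelta2` evaluation at `m * n`, so the
claims are the counts `numColorings_add` and `numColorings_mul`. -/
theorem colorHom_isDoubleBialgebraHom [CharZero K] : IsDoubleBialgebraHom (colorHom K) where
  map_delta1 := by
    classical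
    apply MvPolynomial.algHom_ext
    intro π
    refine tensor_ext_evalPair fun m n => ?_
    simp only [AlgHom.comp_apply]
    rw [evalPair_polyDelta1, colorHom_X, NCPartition.eval_colorPoly, NCPartition.numColorings_add,
      ncDelta1, MvPolynomial.aeval_X]
    simp only [map_sum, Algebra.TensorProduct.map_tmul, evalPair_tmul, eval_colorHom_gen,
      NCPartition.restrictProd, map_prod, Polynomial.eval_prod]
    push_cast
    exact Finset.sum_congr (by congr!) fun _ _ => rfl
  map_counit1 := by
    apply MvPolynomial.algHom_ext
    intro π
    have := NCPartition.eval_colorPoly K π.toNCPartition 0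
    rw [NCPartition.numColorings_zero π.blocks_nonempty] at this
    simpa [polyCounit1, ncCounit1, colorHom_X, Polynomial.coe_aeval_eq_eval] using this
  map_delta2 := by
    apply MvPolynomial.algHom_ext
    intro π
    refine tensor_ext_evalPair fun m n => ?_
    simp only [AlgHom.comp_apply]
    rw [evalPair_polyDelta2, colorHom_X, NCPartition.eval_colorPoly, NCPartition.numColorings_mul,
      ncDelta2, MvPolynomial.aeval_X]
    simp only [map_sum, Algebra.TensorProduct.map_tmul, evalPair_tmul, eval_colorHom_gen,
      NCPartition.contractionProd, map_prod, Polynomial.eval_prod]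
    push_cast
    rfl
  map_counit2 := by
    apply MvPolynomial.algHom_ext
    intro π
    have := NCPartition.eval_colorPoly K π.toNCPartition 1
    rw [NCPartition.numColorings_one π.blocks_nonempty] at this
    simpa [polyCounit2, ncCounit2, colorHom_X, Polynomial.coe_aeval_eq_eval] using this

-- Evaluation at 1 after φ is the counit of δ. Compatibility with Δ then expresses evaluation at 1 +
-- n after φ through that counit and evaluation at n after φ, and evaluation at 0 is the counit of
-- Δ. Compatibility with δ itself is not needed.
variable {K} in
theorem IsDoubleBialgebraHom.unique [CharZero K] {φ ψ : NCAlg K →ₐ[K] Polynomial K}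
    (hφ : IsDoubleBialgebraHom φ) (hψ : IsDoubleBialgebraHom ψ) : φ = ψ := by
  have step : ∀ φ : NCAlg K →ₐ[K] Polynomial K, IsDoubleBialgebraHom φ → ∀ n : ℕ,
      (Polynomial.aeval ((1 + n : ℕ) : K)).comp φ =
        (Algebra.TensorProduct.lift (ncCounit2 K) ((Polynomial.aeval (n : K)).comp φ)
          fun _ _ => Commute.all _ _).comp (ncDelta1 K) := by
    intro φ h n
    have e : (Algebra.TensorProduct.lift (ncCounit2 K) ((Polynomial.aeval (n : K)).comp φ)
        fun _ _ => Commute.all _ _) =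
        (evalPair K 1 n).comp (Algebra.TensorProduct.map φ φ) := by
      apply Algebra.TensorProduct.ext'
      intro a b
      rw [← h.map_counit2]
      simp [evalPair_tmul, polyCounit2, Polynomial.coe_aeval_eq_eval]
    rw [e, AlgHom.comp_assoc, h.map_delta1]
    ext1 π
    simp [evalPair_polyDelta1, Polynomial.coe_aeval_eq_eval]
  have main : ∀ n : ℕ, (Polynomial.aeval (n : K)).comp φ = (Polynomial.aeval (n : K)).comp ψ := by
    intro n
    induction n with
    | zero =>
      have h1 := hφ.map_counit1
      rw [← hψ.map_counit1] at h1
      simpa [polyCounit1] using h1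
    | succ n ih => rw [add_comm, step φ hφ, step ψ hψ]; simp only [ih]
  ext1 π
  refine polynomial_ext_nat fun n => ?_
  simpa [Polynomial.coe_aeval_eq_eval] using DFunLike.congr_fun (main n) (MvPolynomial.X π)

end Algebra

/-! ### Collapsing two consecutive values of a linear extension -/

/-- Without `b` the map still reaches all `m` values, since `a` takes over the value of `b`. Only
`m` elements remain, so it is injective on them. -/
theorem injOn_ne_of_surjective {B : Type*} [Fintype B] [DecidableEq B] {m : ℕ}
    (hB : Fintype.card B = m + 1) {g : B → Fin m} (hg : Function.Surjective g) {a b : B}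
    (hab : a ≠ b) (h : g a = g b) {x y : B} (hx : x ≠ b) (hy : y ≠ b) (hxy : g x = g y) :
    x = y := by
  have himg : (Finset.univ.erase b).image g = Finset.univ := by
    refine Finset.eq_univ_of_forall fun i => ?_
    obtain ⟨z, rfl⟩ := hg i
    by_cases hz : z = b
    · exact Finset.mem_image.2 ⟨a, by simpa using hab, by rw [hz, h]⟩
    · exact Finset.mem_image_of_mem _ (by simpa using hz)
  have hcard : ((Finset.univ.erase b).image g).card = (Finset.univ.erase b).card := by
    rw [himg, Finset.card_erase_of_mem (Finset.mem_univ _), Finset.card_univ, Finset.card_univ, hB]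
    simp
  exact Finset.card_image_iff.1 hcard (by simpa using hx) (by simpa using hy) hxy

theorem collision_unique {B : Type*} [Fintype B] [DecidableEq B] {m : ℕ}
    (hB : Fintype.card B = m + 1) {g : B → Fin m} (hg : Function.Surjective g) {a b : B}
    (hab : a ≠ b) (h : g a = g b) {x y : B} (hne : x ≠ y) (hxy : g x = g y) :
    x = a ∧ y = b ∨ x = b ∧ y = a := by
  have h1 := fun hx hy => hne (injOn_ne_of_surjective hB hg hab h hx hy hxy)
  have h2 := fun hx hy => hne (injOn_ne_of_surjective hB hg hab.symm h.symm hx hy hxy)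
  by_cases hxb : x = b
  · by_cases hya : y = a
    · exact Or.inr ⟨hxb, hya⟩
    · exact (h2 (fun e => hab (e.symm.trans hxb)) hya).elim
  · by_cases hyb : y = b
    · by_cases hxa : x = a
      · exact Or.inl ⟨hxa, hyb⟩
      · exact (h2 hxa fun e => hab (e.symm.trans hyb)).elim
    · exact (h1 hxb hyb).elim

open scoped Classical in
/-- A linear extension together with two consecutive values is the same as an order preserving
surjection with one collision, together with an admissible order of the two colliding elements. -/
theorem mul_card_linearExtensions {B : Type*} [Fintype B] [DecidableEq B] {m : ℕ}
    (hB : Fintype.card B = m + 1) (R : B → B → Prop) :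
    m * (Finset.univ.filter fun f : B → Fin (m + 1) =>
        Function.Surjective f ∧ ∀ x y, R x y → f x ≤ f y).card =
      (Finset.univ.filter fun t : (B → Fin m) × B × B =>
        Function.Surjective t.1 ∧ (∀ x y, R x y → t.1 x ≤ t.1 y) ∧ t.2.1 ≠ t.2.2 ∧
          t.1 t.2.1 = t.1 t.2.2 ∧ ¬ R t.2.2 t.2.1).card := by
  have hprod : ∀ s : Finset (B → Fin (m + 1)),
      m * s.card = (s ×ˢ (Finset.univ : Finset (Fin m))).card := fun s => by
    rw [Finset.card_product, Finset.card_univ, Fintype.card_fin, mul_comm]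
  rw [hprod]
  symm
  -- The common value i of the pair is split: the first element keeps i, the second receives i + 1,
  -- and all larger values move up by one.
  let e : (B → Fin m) × B × B → (B → Fin (m + 1)) × Fin m := fun t =>
    (fun x => if x = t.2.2 ∨ t.1 t.2.2 < t.1 x then (t.1 x).succ else (t.1 x).castSucc, t.1 t.2.2)
  have he : ∀ t x, ((e t).1 x : ℕ) =
      if x = t.2.2 ∨ (t.1 t.2.2 : ℕ) < t.1 x then (t.1 x : ℕ) + 1 else t.1 x := by
    intro t x
    simp only [e, Fin.lt_def]
    split_ifs <;> simp
  refine Finset.card_nbij e ?_ ?_ ?_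
  · rintro ⟨g, a, b⟩ ht
    simp only [Finset.coe_filter, Finset.mem_univ, true_and, Set.mem_ofPred_eq] at ht
    obtain ⟨hg, hmono, hab, hgab, hR⟩ := ht
    simp only [Finset.coe_product, Finset.coe_filter, Finset.mem_univ, true_and, Set.mem_prod,
      Finset.coe_univ, Set.mem_univ, and_true, Set.mem_ofPred_eq]
    constructor
    · have hinj : Function.Injective (e (g, a, b)).1 := by
        intro x y hxy
        by_contra hne
        have hv := congrArg Fin.val hxy
        rw [he, he] at hv
        simp only at hv
        by_cases hgxy : g x = g y
        · rcases collision_unique hB hg hab hgab hne hgxy with ⟨rfl, rfl⟩ | ⟨rfl, rfl⟩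
          · rw [hgab] at hv
            simp [hab] at hv
          · rw [hgab] at hv
            simp [hab] at hv
        · have hne' : (g x : ℕ) ≠ g y := fun h => hgxy (Fin.ext h)
          by_cases hx : x = b
          · have hy : y ≠ b := fun h => hne (hx.trans h.symm)
            subst hx
            simp only [true_or, if_true, hy, false_or] at hv
            split_ifs at hv <;> omega
          · by_cases hy : y = b
            · subst hy
              simp only [true_or, if_true, hx, false_or] at hv
              split_ifs at hv <;> omega
            · simp only [hx, hy, false_or] at hv
              split_ifs at hv <;> omega
      exact ((Fintype.bijective_iff_injective_and_card _).2 ⟨hinj, by simp [hB]⟩).2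
    · intro x y hxy
      have h1 := hmono x y hxy
      rw [Fin.le_def] at h1 ⊢
      rw [he, he]
      simp only
      by_cases hx : x = b
      · subst hx
        by_cases hy : y = x
        · simp [hy]
        -- Raising `b` could break monotonicity only against an element with the same value. That
        -- element is `a`, and R b a is excluded.
        · have : (g x : ℕ) ≠ g y := by
            intro h
            rcases collision_unique hB hg hab hgab (Ne.symm hy) (Fin.ext h) with h | h
            · exact hab h.1.symm
            · exact hR (h.2 ▸ hxy)
          simp only [true_or, if_true, hy, false_or]
          split_ifs <;> omega
      · by_cases hy : y = b
        · subst hy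
          simp only [true_or, if_true, hx, false_or]
          split_ifs <;> omega
        · simp only [hx, hy, false_or]
          split_ifs <;> omega
  · rintro ⟨g, a, b⟩ ht ⟨g', a', b'⟩ ht' h
    simp only [Finset.coe_filter, Finset.mem_univ, true_and, Set.mem_ofPred_eq] at ht ht'
    have hi : (g b : ℕ) = g' b' := congrArg Fin.val (congrArg Prod.snd h)
    have hf : ∀ x, ((if x = b ∨ (g b : ℕ) < g x then (g x : ℕ) + 1 else g x : ℕ)) =
        if x = b' ∨ (g' b' : ℕ) < g' x then (g' x : ℕ) + 1 else g' x := by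
      intro x
      have := congrArg Fin.val (congrFun (congrArg Prod.fst h) x)
      rwa [he, he] at this
    -- The second element of the pair is recovered as the one whose new value is i + 1.
    have hb : b = b' := by
      by_contra hne
      have h1 := hf b
      simp only [true_or, if_true, hne, false_or] at h1
      have h2 := hf b'
      simp only [true_or, if_true, Ne.symm hne, false_or] at h2
      have hne2 : (g b : ℕ) ≠ g b' ∨ b' = a := by
        by_cases h3 : (g b : ℕ) = g b'
        · rcases collision_unique hB ht.1 ht.2.2.1 ht.2.2.2.1 hne (Fin.ext h3) with h4 | h4
          · exact (ht.2.2.1 h4.1.symm).elim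
          · exact Or.inr h4.2
        · exact Or.inl h3
      rcases hne2 with h3 | h3
      · split_ifs at h1 h2 <;> omega
      · have : (g b' : ℕ) = g b := by rw [h3, ht.2.2.2.1]
        split_ifs at h1 h2 <;> omega
    subst hb
    have hgg : g = g' := by
      funext x
      apply Fin.ext
      by_cases hx : x = b
      · rw [hx, hi]
      · have h1 := hf x
        simp only [hx, false_or] at h1
        split_ifs at h1 <;> omega
    subst hgg
    have ha : a = a' := by
      refine injOn_ne_of_surjective hB ht.1 ht.2.2.1 ht.2.2.2.1 ht.2.2.1 ht'.2.2.1 ?_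
      rw [ht.2.2.2.1, ht'.2.2.2.1]
    rw [ha]
  · rintro ⟨f, i⟩ hf
    simp only [Finset.coe_product, Finset.coe_filter, Finset.mem_univ, true_and, Set.mem_prod,
      Finset.coe_univ, Set.mem_univ, and_true, Set.mem_ofPred_eq] at hf
    obtain ⟨hsurj, hmono⟩ := hf
    obtain ⟨a, ha⟩ := hsurj i.castSucc
    obtain ⟨b, hb⟩ := hsurj i.succ
    have hinj : Function.Injective f :=
      ((Fintype.bijective_iff_surjective_and_card f).2 ⟨hsurj, by simp [hB]⟩).1
    -- The inverse identifies the values i and i + 1; `a` and `b` are the elements that carried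
    -- them.
    let g : B → Fin m := fun x => if h : (i : ℕ) < f x then ⟨f x - 1, by omega⟩
      else ⟨f x, by omega⟩
    have hg : ∀ x, (g x : ℕ) = if (i : ℕ) < f x then (f x : ℕ) - 1 else f x := by
      intro x
      simp only [g]
      split_ifs <;> rfl
    have hfa : (f a : ℕ) = i := by rw [ha]; rfl
    have hfb : (f b : ℕ) = i + 1 := by rw [hb]; rfl
    have hga : (g a : ℕ) = i := by rw [hg, hfa]; simp
    have hgb : (g b : ℕ) = i := by rw [hg, hfb]; simp
    refine ⟨(g, a, b), ?_, ?_⟩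
    · simp only [Finset.coe_filter, Finset.mem_univ, true_and, Set.mem_ofPred_eq]
      refine ⟨fun j => ?_, fun x y hxy => ?_, ?_, Fin.ext (hga.trans hgb.symm), fun h => ?_⟩
      · by_cases hj : (j : ℕ) ≤ i
        · obtain ⟨x, hx⟩ := hsurj j.castSucc
          refine ⟨x, Fin.ext ?_⟩
          rw [hg, hx, Fin.val_castSucc, if_neg (by omega)]
        · obtain ⟨x, hx⟩ := hsurj j.succ
          refine ⟨x, Fin.ext ?_⟩
          rw [hg, hx]
          have : (i : ℕ) < j + 1 := by omega
          simp [this]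
      · have := Fin.le_def.1 (hmono x y hxy)
        rw [Fin.le_def, hg, hg]
        split_ifs <;> omega
      · rintro rfl
        omega
      · have := Fin.le_def.1 (hmono b a h)
        omega
    · refine Prod.ext (funext fun x => Fin.ext ?_) (Fin.ext hgb)
      rw [he]
      simp only [hgb, hg x]
      by_cases hx : x = b
      · subst hx
        simp [hfb]
      · have : (f x : ℕ) ≠ i + 1 := by
          intro h
          exact hx (hinj (Fin.ext (by omega)))
        simp only [hx, false_or]
        split_ifs <;> omega

open scoped Classical in
theorem le_eq_card_surjective {P : Finset (Finset ℕ)} {k : ℕ} (h : P.card = k) :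
    le P = (Finset.univ.filter fun f : P → Fin k =>
      Function.Surjective f ∧ ∀ b b' : P, NestLE b b' → f b ≤ f b').card := by
  subst h
  rw [le, ← Fintype.card_subtype, Nat.card_eq_fintype_card]
  refine Fintype.card_congr
    { toFun := fun f => ⟨f.1, f.1.surjective, f.2⟩
      invFun := fun f => ⟨Equiv.ofBijective f.1
        ((Fintype.bijective_iff_surjective_and_card f.1).2 ⟨f.2.1, by simp⟩), f.2.2⟩
      left_inv := fun f => by ext; rfl
      right_inv := fun f => rfl }

/-! ### Geometry of blocks -/

theorem bmin_le {b : Finset ℕ} {x : ℕ} (hx : x ∈ b) : bmin b ≤ x := by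
  rw [bmin, dif_pos ⟨x, hx⟩]; exact b.min'_le x hx

theorem le_bmax {b : Finset ℕ} {x : ℕ} (hx : x ∈ b) : x ≤ bmax b := by
  rw [bmax, dif_pos ⟨x, hx⟩]; exact b.le_max' x hx

theorem nestLE_iff {b b' : Finset ℕ} (h : b'.Nonempty) :
    NestLE b b' ↔ bmin b ≤ bmin b' ∧ bmax b' ≤ bmax b := by
  constructor
  · intro hn
    exact ⟨(Finset.mem_Icc.1 (hn (NCPartition.bmin_mem h))).1,
      (Finset.mem_Icc.1 (hn (NCPartition.bmax_mem h))).2⟩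
  · rintro ⟨h1, h2⟩ x hx
    exact Finset.mem_Icc.2 ⟨h1.trans (bmin_le hx), (le_bmax hx).trans h2⟩

theorem bmin_union {a b : Finset ℕ} (ha : a.Nonempty) (hb : b.Nonempty) :
    bmin (a ∪ b) = min (bmin a) (bmin b) := by
  have hu : (a ∪ b).Nonempty := ha.mono Finset.subset_union_left
  apply le_antisymm
  · exact le_min (bmin_le (Finset.mem_union_left _ (NCPartition.bmin_mem ha)))
      (bmin_le (Finset.mem_union_right _ (NCPartition.bmin_mem hb)))
  · rcases Finset.mem_union.1 (NCPartition.bmin_mem hu) with h | h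
    · exact (min_le_left _ _).trans (bmin_le h)
    · exact (min_le_right _ _).trans (bmin_le h)

theorem bmax_union {a b : Finset ℕ} (ha : a.Nonempty) (hb : b.Nonempty) :
    bmax (a ∪ b) = max (bmax a) (bmax b) := by
  have hu : (a ∪ b).Nonempty := ha.mono Finset.subset_union_left
  apply le_antisymm
  · rcases Finset.mem_union.1 (NCPartition.bmax_mem hu) with h | h
    · exact (le_bmax h).trans (le_max_left _ _)
    · exact (le_bmax h).trans (le_max_right _ _)
  · exact max_le (le_bmax (Finset.mem_union_left _ (NCPartition.bmax_mem ha)))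
      (le_bmax (Finset.mem_union_right _ (NCPartition.bmax_mem hb)))

namespace NCPartition

variable {π : NCPartition} {a b d : Finset ℕ}

theorem bmin_le_bmax (ha : a ∈ π.blocks) : bmin a ≤ bmax a :=
  bmin_le (bmax_mem (π.nonempty_of_mem a ha))

theorem nestLE_iff_of_mem (hb : b ∈ π.blocks) :
    NestLE a b ↔ bmin a ≤ bmin b ∧ bmax b ≤ bmax a :=
  nestLE_iff (π.nonempty_of_mem b hb)

theorem bmin_ne (ha : a ∈ π.blocks) (hb : b ∈ π.blocks) (h : a ≠ b) : bmin a ≠ bmin b :=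
  fun e => h (block_unique ha hb (bmin_mem (π.nonempty_of_mem a ha))
    (e ▸ bmin_mem (π.nonempty_of_mem b hb)))

theorem ne_of_mem_of_mem (ha : a ∈ π.blocks) (hb : b ∈ π.blocks) (h : a ≠ b) {x y : ℕ}
    (hx : x ∈ a) (hy : y ∈ b) : x ≠ y :=
  fun e => h (block_unique ha hb hx (e ▸ hy))

theorem nestLE_antisymm (ha : a ∈ π.blocks) (hb : b ∈ π.blocks) (h : NestLE a b)
    (h' : NestLE b a) : a = b := by
  rw [nestLE_iff_of_mem hb] at h
  rw [nestLE_iff_of_mem ha] at h'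
  by_contra hne
  have := bmin_ne ha hb hne
  omega

/-- If the hulls of two blocks overlapped without nesting, the minima and maxima would form a
crossing. -/
theorem nest_or_left (ha : a ∈ π.blocks) (hb : b ∈ π.blocks) (hne : a ≠ b) :
    NestLE a b ∨ NestLE b a ∨ bmax a < bmin b ∨ bmax b < bmin a := by
  have main : ∀ a ∈ π.blocks, ∀ b ∈ π.blocks, a ≠ b → bmin a < bmin b →
      NestLE a b ∨ bmax a < bmin b := by
    intro a ha b hb hne hlt
    rw [nestLE_iff_of_mem hb]
    by_contra! hcon
    obtain ⟨h1, h2⟩ := hcon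
    have h3 := h1 hlt.le
    have na := π.nonempty_of_mem a ha
    have nb := π.nonempty_of_mem b hb
    have h4 := ne_of_mem_of_mem ha hb hne (bmax_mem na) (bmin_mem nb)
    exact π.noncrossing a ha b hb hne _ (bmin_mem na) _ (bmax_mem na) _ (bmin_mem nb) _
      (bmax_mem nb) ⟨hlt, by omega, h3⟩
  rcases lt_or_gt_of_ne (bmin_ne ha hb hne) with h | h
  · rcases main a ha b hb hne h with h | h <;> tauto
  · rcases main b hb a ha hne.symm h with h | h <;> tauto

/-- A block strictly surrounding `b` has no element between two elements of `b`. -/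
theorem not_mem_between (hb : b ∈ π.blocks) (hd : d ∈ π.blocks) (hne : d ≠ b) (h : NestLE d b)
    {z : ℕ} (hz : z ∈ d) : ¬ (bmin b ≤ z ∧ z ≤ bmax b) := by
  rintro ⟨h1, h2⟩
  have nb := π.nonempty_of_mem b hb
  have nd := π.nonempty_of_mem d hd
  have h3 := ne_of_mem_of_mem hd hb hne hz (bmin_mem nb)
  have h4 := ne_of_mem_of_mem hd hb hne hz (bmax_mem nb)
  have h5 := bmin_ne hd hb hne
  rw [nestLE_iff_of_mem hb] at h
  exact π.noncrossing d hd b hb hne _ (bmin_mem nd) _ hz _ (bmin_mem nb) _ (bmax_mem nb)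
    ⟨by omega, by omega, by omega⟩

theorem nestLE_of_between (hb : b ∈ π.blocks) (hd : d ∈ π.blocks) {z : ℕ} (hz : z ∈ d)
    (h1 : bmin b ≤ z) (h2 : z ≤ bmax b) : NestLE b d := by
  by_cases hne : b = d
  · subst hne
    exact (nestLE_iff_of_mem hb).2 ⟨le_rfl, le_rfl⟩
  · have := bmin_le hz
    have := le_bmax hz
    rcases nest_or_left hb hd hne with h | h | h | h
    · exact h
    · exact (not_mem_between hb hd (Ne.symm hne) h hz ⟨h1, h2⟩).elim
    · omega
    · omega

/-- A block strictly surrounding `a` has an element beyond `bmax a`. As `b` starts at the very next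
integer, that element cannot fall before `b`, nor inside its hull, so `b` is surrounded too; the
converse is symmetric. -/
theorem Follows.nest_iff (h : π.Follows a b) (hd : d ∈ π.blocks) :
    (NestLE d a ∧ d ≠ a) ↔ (NestLE d b ∧ d ≠ b) := by
  obtain ⟨ha, hb, hab⟩ := h
  have la := bmin_le_bmax ha
  have lb := bmin_le_bmax hb
  have ld := bmin_le_bmax hd
  have nd := π.nonempty_of_mem d hd
  constructor
  · rintro ⟨h1, h2⟩
    have h3 := not_mem_between ha hd h2 h1 (bmax_mem nd)
    rw [nestLE_iff_of_mem ha] at h1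
    have hdb : d ≠ b := by rintro rfl; omega
    refine ⟨?_, hdb⟩
    rcases nest_or_left hd hb hdb with h | h | h | h
    · exact h
    · rw [nestLE_iff_of_mem hd] at h; omega
    · omega
    · omega
  · rintro ⟨h1, h2⟩
    have h3 := not_mem_between hb hd h2 h1 (bmin_mem nd)
    rw [nestLE_iff_of_mem hb] at h1
    have hda : d ≠ a := by rintro rfl; omega
    refine ⟨?_, hda⟩
    rcases nest_or_left hd ha hda with h | h | h | h
    · exact h
    · rw [nestLE_iff_of_mem hd] at h; omega
    · omega
    · omega

theorem chain_nest_iff (h : Relation.ReflTransGen π.Follows a b) (hd : d ∈ π.blocks) :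
    (NestLE d a ∧ d ≠ a) ↔ (NestLE d b ∧ d ≠ b) := by
  induction h with
  | refl => exact Iff.rfl
  | tail _ h ih => exact ih.trans (h.nest_iff hd)

theorem chain_bounds (ha : a ∈ π.blocks) (h : Relation.ReflTransGen π.Follows a b) :
    b ∈ π.blocks ∧ bmin a ≤ bmin b ∧ bmax a ≤ bmax b := by
  induction h with
  | refl => exact ⟨ha, le_rfl, le_rfl⟩
  | tail _ h ih =>
    obtain ⟨h1, h2, h3⟩ := h
    have := bmin_le_bmax h1
    have := bmin_le_bmax h2
    exact ⟨h2, by omega, by omega⟩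

theorem chain_not_mem (ha : a ∈ π.blocks) (h : Relation.ReflTransGen π.Follows a b)
    (hd : d ∈ π.blocks) (hne : d ≠ a) (hda : NestLE d a) {z : ℕ} (hz : z ∈ d) :
    ¬ (bmin a ≤ z ∧ z ≤ bmax b) := by
  induction h with
  | refl => exact not_mem_between ha hd hne hda hz
  | tail h0 h ih =>
    rintro ⟨h1, h2⟩
    obtain ⟨h3, h4⟩ := (chain_nest_iff (h0.tail h) hd).1 ⟨hda, hne⟩
    have h5 := not_mem_between h.2.1 hd h4 h3 hz
    have := h.2.2
    omega

/-- Minima do not decrease along a chain, so a chain from `b` to `a` is incompatible with `a` lying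
to the left of `b`. -/
theorem IsClosePair.chain (h : π.IsClosePair a b) : Relation.ReflTransGen π.Follows a b := by
  obtain ⟨ha, hb, _, hlt, h | h⟩ := h
  · exact h
  · have := (chain_bounds hb h).2.1
    have := bmin_le_bmax ha
    omega

/-! ### Validity in terms of nesting and separation -/

/-- Some block with a colour smaller than that of `a` has an element between `a` and `b`. -/
def Separated (π : NCPartition) (f : π.blocks → ℕ) (a b : Finset ℕ) (i : ℕ) : Prop :=
  ∃ d : π.blocks, ∃ z ∈ d.1, bmax a < z ∧ z < bmin b ∧ f d < i

/-- Monotonicity says that nothing inside the hull of a block has a smaller colour. Two blocks of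
one colour therefore always join if nested; if side by side, only the gap between them can hold them
apart. -/
theorem validOnBlocks_iff {π : NCPartition} {f : π.blocks → ℕ} :
    π.ValidOnBlocks f ↔ (∀ a b : π.blocks, NestLE a b → f a ≤ f b) ∧
      ∀ a b : π.blocks, a ≠ b → f a = f b → ¬ NestLE a.1 b ∧
        (bmax a.1 < bmin b.1 → π.Separated f a b (f a)) := by
  have ne : ∀ b : π.blocks, b.1.Nonempty := fun b => π.nonempty_of_mem b.1 b.2
  constructor
  · intro h
    have hmono : ∀ a b : π.blocks, NestLE a b → f a ≤ f b := by
      intro a b hab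
      rw [nestLE_iff_of_mem b.2] at hab
      have := bmin_le_bmax b.2
      refine ((h a a _ (bmin_mem (ne a)) _ (bmax_mem (ne a))).1 rfl).2 b _ (bmin_mem (ne b)) ?_ ?_
        <;> omega
    refine ⟨hmono, fun a b hne hab => ⟨fun hn => hne ?_, fun hlt => ?_⟩⟩
    · refine (h a b _ (bmin_mem (ne a)) _ (bmin_mem (ne b))).2 ⟨hab, fun d z hz h1 h2 => ?_⟩
      have := bmin_le_bmax a.2
      have := bmin_le_bmax b.2
      rw [nestLE_iff_of_mem b.2] at hn
      exact hmono a d (nestLE_of_between a.2 d.2 hz (by omega) (by omega))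
    · by_contra hsep
      refine hne ((h a b _ (bmax_mem (ne a)) _ (bmin_mem (ne b))).2 ⟨hab, fun d z hz h1 h2 => ?_⟩)
      by_contra! hlt'
      have hda : d ≠ a := by rintro rfl; omega
      have hdb : d ≠ b := by rintro rfl; omega
      have h3 := ne_of_mem_of_mem d.2 a.2 (fun e => hda (Subtype.ext e)) hz (bmax_mem (ne a))
      have h4 := ne_of_mem_of_mem d.2 b.2 (fun e => hdb (Subtype.ext e)) hz (bmin_mem (ne b))
      exact hsep ⟨d, z, hz, by omega, by omega, hlt'⟩
  · rintro ⟨hmono, hcol⟩ a b x hx y hy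
    have := bmin_le hx
    have := le_bmax hx
    have := bmin_le hy
    have := le_bmax hy
    constructor
    · rintro rfl
      refine ⟨rfl, fun d z hz h1 h2 => hmono a d ?_⟩
      exact nestLE_of_between a.2 d.2 hz (by omega) (by omega)
    · rintro ⟨hab, hbt⟩
      by_contra hne
      have h1 := hcol a b hne hab
      have h2 := hcol b a (Ne.symm hne) hab.symm
      rcases nest_or_left a.2 b.2 (fun e => hne (Subtype.ext e)) with h | h | h | h
      · exact h1.1 h
      · exact h2.1 h
      · obtain ⟨d, z, hz, h3, h4, h5⟩ := h1.2 h
        have := hbt d z hz (by omega) (by omega)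
        omega
      · obtain ⟨d, z, hz, h3, h4, h5⟩ := h2.2 h
        have := hbt d z hz (by omega) (by omega)
        omega

/-! ### Merging two blocks -/

/-- The block of `π / (a, b)` that contains the block `x` of `π`. -/
def mergedBlock (a b x : Finset ℕ) : Finset ℕ := if x = a ∨ x = b then a ∪ b else x

/-- `g` preserves the nesting order of `π / (a, b)`. -/
def MergedMono (π : NCPartition) {m : ℕ} (a b : Finset ℕ) (g : π.blocks → Fin m) : Prop :=
  ∀ x y : π.blocks, NestLE (mergedBlock a b x) (mergedBlock a b y) → g x ≤ g y

theorem union_notMem {π : NCPartition} {a b : Finset ℕ} (ha : a ∈ π.blocks) (hb : b ∈ π.blocks)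
    (hab : a ≠ b) : a ∪ b ∉ π.blocks := by
  intro h
  obtain ⟨x, hx⟩ := π.nonempty_of_mem a ha
  obtain ⟨y, hy⟩ := π.nonempty_of_mem b hb
  have h1 := block_unique h ha (Finset.mem_union_left _ hx) hx
  have h2 := block_unique h hb (Finset.mem_union_right _ hy) hy
  exact hab (h1.symm.trans h2)

theorem card_merge {π : NCPartition} {m : ℕ} (hm : π.blocks.card = m + 1) {a b : Finset ℕ}
    (ha : a ∈ π.blocks) (hb : b ∈ π.blocks) (hab : a ≠ b) : (π.merge a b).card = m := by
  have hsub : ({a, b} : Finset (Finset ℕ)) ⊆ π.blocks := by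
    intro x hx
    rcases Finset.mem_insert.1 hx with rfl | hx
    · exact ha
    · rwa [Finset.mem_singleton.1 hx]
  have hc := Finset.card_le_card hsub
  rw [Finset.card_pair hab] at hc
  rw [merge, Finset.card_insert_of_notMem
    (fun h => union_notMem ha hb hab (Finset.mem_sdiff.1 h).1), Finset.card_sdiff_of_subset hsub,
    Finset.card_pair hab]
  omega

theorem mergedBlock_mem {π : NCPartition} (a b : Finset ℕ) {x : Finset ℕ} (hx : x ∈ π.blocks) :
    mergedBlock a b x ∈ π.merge a b := by
  unfold mergedBlock merge
  split_ifs with h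
  · exact Finset.mem_insert_self _ _
  · refine Finset.mem_insert_of_mem (Finset.mem_sdiff.2 ⟨hx, ?_⟩)
    simpa using h

theorem mergedBlock_eq_iff {π : NCPartition} {a b x y : Finset ℕ} (ha : a ∈ π.blocks)
    (hb : b ∈ π.blocks) (hab : a ≠ b) (hx : x ∈ π.blocks) (hy : y ∈ π.blocks)
    (h : mergedBlock a b x = mergedBlock a b y) :
    x = y ∨ ((x = a ∨ x = b) ∧ (y = a ∨ y = b)) := by
  have hu := union_notMem ha hb hab
  unfold mergedBlock at h
  split_ifs at h with h1 h2 h2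
  · exact Or.inr ⟨h1, h2⟩
  · exact (hu (h ▸ hy)).elim
  · exact (hu (h ▸ hx)).elim
  · exact Or.inl h

-- Pulling back along the map from blocks of `π` to blocks of the merged partition identifies linear
-- extensions of the latter with surjections that are constant on the pair and monotone for the
-- merged order.
open scoped Classical in
theorem le_merge {π : NCPartition} {m : ℕ} (hm : π.blocks.card = m + 1) (a b : π.blocks)
    (hab : a ≠ b) : le (π.merge a b) =
      (Finset.univ.filter fun g : π.blocks → Fin m =>
        Function.Surjective g ∧ g a = g b ∧ π.MergedMono a b g).card := by
  have hab' : a.1 ≠ b.1 := fun e => hab (Subtype.ext e)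
  rw [le_eq_card_surjective (card_merge hm a.2 b.2 hab')]
  let q : π.blocks → π.merge a b := fun x => ⟨mergedBlock a b x, mergedBlock_mem _ _ x.2⟩
  have hq : Function.Surjective q := by
    rintro ⟨y, hy⟩
    rcases Finset.mem_insert.1 hy with rfl | hy'
    · exact ⟨a, Subtype.ext (if_pos (Or.inl rfl))⟩
    · rw [Finset.mem_sdiff] at hy'
      exact ⟨⟨y, hy'.1⟩, Subtype.ext (if_neg (by simpa using hy'.2))⟩
  refine Finset.card_nbij (fun h => h ∘ q) ?_ ?_ ?_
  · intro h hh
    simp only [Finset.coe_filter, Finset.mem_univ, true_and, Set.mem_ofPred_eq] at hh ⊢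
    refine ⟨hh.1.comp hq, congrArg h (Subtype.ext ?_), fun x y hxy => hh.2 _ _ hxy⟩
    simp [q, mergedBlock]
  · intro h _ h' _ e
    exact hq.injective_comp_right e
  · intro g hg
    simp only [Finset.coe_filter, Finset.mem_univ, true_and, Set.mem_ofPred_eq] at hg
    obtain ⟨h1, h2, h3⟩ := hg
    have hfac : ∀ x y, q x = q y → g x = g y := by
      intro x y hxy
      rcases mergedBlock_eq_iff a.2 b.2 hab' x.2 y.2 (congrArg Subtype.val hxy) with h | ⟨h, h'⟩
      · rw [Subtype.ext h]
      · simp only [← Subtype.ext_iff] at h h'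
        rcases h with rfl | rfl <;> rcases h' with rfl | rfl <;> simp [h2]
    have hcomp : (g ∘ Function.surjInv hq) ∘ q = g :=
      funext fun x => hfac _ _ (Function.surjInv_eq hq _)
    refine ⟨g ∘ Function.surjInv hq, ?_, hcomp⟩
    simp only [Finset.coe_filter, Finset.mem_univ, true_and, Set.mem_ofPred_eq]
    constructor
    · rw [← hcomp] at h1
      exact h1.of_comp
    · intro x y hxy
      refine h3 _ _ ?_
      have e1 := congrArg Subtype.val (Function.surjInv_eq hq x)
      have e2 := congrArg Subtype.val (Function.surjInv_eq hq y)
      simp only [q] at e1 e2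
      rwa [e1, e2]

section

variable {π : NCPartition} {m : ℕ} {g : π.blocks → Fin m} {a b : π.blocks}

theorem nestLE_mergedBlock_iff (a b x y : π.blocks) :
    NestLE (mergedBlock a.1 b x) (mergedBlock a.1 b y) ↔
      bmin (mergedBlock a.1 b x) ≤ bmin (mergedBlock a.1 b y) ∧
        bmax (mergedBlock a.1 b y) ≤ bmax (mergedBlock a.1 b x) := by
  apply nestLE_iff
  unfold mergedBlock
  split_ifs
  · exact (π.nonempty_of_mem _ a.2).mono Finset.subset_union_left
  · exact π.nonempty_of_mem _ y.2

theorem bmin_mergedBlock (a b x : π.blocks) : bmin (mergedBlock a.1 b x) =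
    if x = a ∨ x = b then min (bmin a) (bmin b) else bmin x := by
  unfold mergedBlock
  simp only [← Subtype.ext_iff]
  split_ifs
  · exact bmin_union (π.nonempty_of_mem _ a.2) (π.nonempty_of_mem _ b.2)
  · rfl

theorem bmax_mergedBlock (a b x : π.blocks) : bmax (mergedBlock a.1 b x) =
    if x = a ∨ x = b then max (bmax a) (bmax b) else bmax x := by
  unfold mergedBlock
  simp only [← Subtype.ext_iff]
  split_ifs
  · exact bmax_union (π.nonempty_of_mem _ a.2) (π.nonempty_of_mem _ b.2)
  · rfl

/-- The union has the same hull as `a`. The only comparison that might be lost concerns a third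
block surrounding `b`; no block lies strictly between `a` and `b`, so it surrounds `a` as well. -/
theorem mergedMono_iff_of_nested (h : π.IsNestedPair a b) (hg : g a = g b) :
    π.MergedMono a b g ↔ ∀ x y : π.blocks, NestLE x y → g x ≤ g y := by
  obtain ⟨_, _, hne, hab, hcov⟩ := h
  have hab' := (nestLE_iff_of_mem b.2).1 hab
  unfold MergedMono
  simp only [nestLE_mergedBlock_iff, bmin_mergedBlock, bmax_mergedBlock, min_eq_left hab'.1,
    max_eq_left hab'.2]
  have hgx : ∀ x : π.blocks, x = a ∨ x = b → g x = g a := by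
    rintro x (rfl | rfl)
    · rfl
    · exact hg.symm
  constructor
  · intro h x y hxy
    have hxy' := (nestLE_iff_of_mem y.2).1 hxy
    by_cases hx : x = a ∨ x = b
    · by_cases hy : y = a ∨ y = b
      · rw [hgx x hx, hgx y hy]
      · refine h x y ?_
        rw [if_pos hx, if_pos hx, if_neg hy, if_neg hy]
        rcases hx with rfl | rfl <;> omega
    · by_cases hy : y = a ∨ y = b
      · refine h x y ?_
        rw [if_pos hy, if_pos hy, if_neg hx, if_neg hx]
        rcases hy with rfl | rfl
        · exact hxy'
        · have hxa : x.1 ≠ a := fun e => hx (Or.inl (Subtype.ext e))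
          have := bmin_le_bmax y.2
          rcases nest_or_left x.2 a.2 hxa with h | h | h | h
          · exact (nestLE_iff_of_mem a.2).1 h
          · rcases hcov x x.2 h hxy with e | e
            · exact (hxa e).elim
            · exact (hx (Or.inr (Subtype.ext e))).elim
          · omega
          · omega
      · refine h x y ?_
        rwa [if_neg hx, if_neg hx, if_neg hy, if_neg hy]
  · intro h x y hxy
    by_cases hx : x = a ∨ x = b
    · by_cases hy : y = a ∨ y = b
      · rw [hgx x hx, hgx y hy]
      · rw [if_pos hx, if_pos hx, if_neg hy, if_neg hy] at hxy
        rw [hgx x hx]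
        exact h a y ((nestLE_iff_of_mem y.2).2 hxy)
    · by_cases hy : y = a ∨ y = b
      · rw [if_pos hy, if_pos hy, if_neg hx, if_neg hx] at hxy
        rw [hgx y hy]
        exact h x a ((nestLE_iff_of_mem a.2).2 hxy)
      · rw [if_neg hx, if_neg hx, if_neg hy, if_neg hy] at hxy
        exact h x y ((nestLE_iff_of_mem y.2).2 hxy)

/-- The hull of the union runs from `bmin a` to `bmax b`. Blocks surrounding one of the two surround
both, by the chain, so no old comparison is lost. The new ones place the union below every block
lying in the gap, which is precisely the absence of separation. -/
theorem mergedMono_iff_of_close (h : π.IsClosePair a b) (hg : g a = g b) :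
    π.MergedMono a b g ↔ (∀ x y : π.blocks, NestLE x y → g x ≤ g y) ∧
      ¬ π.Separated (fun x => g x) a b (g a) := by
  have hch := h.chain
  obtain ⟨_, _, hne, hlt, _⟩ := h
  have la := bmin_le_bmax a.2
  have lb := bmin_le_bmax b.2
  unfold MergedMono
  simp only [nestLE_mergedBlock_iff, bmin_mergedBlock, bmax_mergedBlock,
    min_eq_left (show bmin a.1 ≤ bmin b.1 by omega),
    max_eq_right (show bmax a.1 ≤ bmax b.1 by omega)]
  have hgx : ∀ x : π.blocks, x = a ∨ x = b → g x = g a := by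
    rintro x (rfl | rfl)
    · rfl
    · exact hg.symm
  constructor
  · intro h
    constructor
    · intro x y hxy
      have hxy' := (nestLE_iff_of_mem y.2).1 hxy
      by_cases hx : x = a ∨ x = b
      · by_cases hy : y = a ∨ y = b
        · rw [hgx x hx, hgx y hy]
        · refine h x y ?_
          rw [if_pos hx, if_pos hx, if_neg hy, if_neg hy]
          rcases hx with rfl | rfl <;> omega
      · by_cases hy : y = a ∨ y = b
        · refine h x y ?_
          rw [if_pos hy, if_pos hy, if_neg hx, if_neg hx]
          have hxa : x.1 ≠ a := fun e => hx (Or.inl (Subtype.ext e))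
          have hxb : x.1 ≠ b := fun e => hx (Or.inr (Subtype.ext e))
          have hxab : NestLE x.1 a ∧ NestLE x.1 b := by
            rcases hy with rfl | rfl
            · exact ⟨hxy, ((chain_nest_iff hch x.2).1 ⟨hxy, hxa⟩).1⟩
            · exact ⟨((chain_nest_iff hch x.2).2 ⟨hxy, hxb⟩).1, hxy⟩
          have h1 := (nestLE_iff_of_mem a.2).1 hxab.1
          have h2 := (nestLE_iff_of_mem b.2).1 hxab.2
          exact ⟨h1.1, h2.2⟩
        · refine h x y ?_
          rwa [if_neg hx, if_neg hx, if_neg hy, if_neg hy]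
    · rintro ⟨d, z, hz, h1, h2, h3⟩
      replace h3 : (g d : ℕ) < g a := h3
      have hda : d ≠ a := by rintro rfl; have := le_bmax hz; omega
      have hdb : d ≠ b := by rintro rfl; have := bmin_le hz; omega
      have hda' : d.1 ≠ a := fun e => hda (Subtype.ext e)
      have hdb' : d.1 ≠ b := fun e => hdb (Subtype.ext e)
      have l1 := bmin_le hz
      have l2 := le_bmax hz
      have hnot : ¬ NestLE d.1 a := fun hn =>
        chain_not_mem a.2 hch d.2 hda' hn hz ⟨by omega, by omega⟩
      have h4 : bmax a.1 < bmin d.1 := by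
        rcases nest_or_left d.2 a.2 hda' with h | h | h | h
        · exact (hnot h).elim
        · rw [nestLE_iff_of_mem d.2] at h; omega
        · omega
        · exact h
      have h5 : bmax d.1 < bmin b.1 := by
        rcases nest_or_left d.2 b.2 hdb' with h | h | h | h
        · exact (hnot ((chain_nest_iff hch d.2).2 ⟨h, hdb'⟩).1).elim
        · rw [nestLE_iff_of_mem d.2] at h; omega
        · exact h
        · omega
      have := h a d (by
        rw [if_pos (Or.inl rfl), if_pos (Or.inl rfl), if_neg (by tauto), if_neg (by tauto)]
        omega)
      rw [Fin.le_def] at this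
      omega
  · rintro ⟨h, hsep⟩ x y hxy
    by_cases hx : x = a ∨ x = b
    · by_cases hy : y = a ∨ y = b
      · rw [hgx x hx, hgx y hy]
      · rw [if_pos hx, if_pos hx, if_neg hy, if_neg hy] at hxy
        rw [hgx x hx]
        have hya : y.1 ≠ a := fun e => hy (Or.inl (Subtype.ext e))
        have hyb : y.1 ≠ b := fun e => hy (Or.inr (Subtype.ext e))
        have ly := bmin_le_bmax y.2
        have n1 := bmin_ne y.2 a.2 hya
        rcases nest_or_left y.2 a.2 hya with h1 | h1 | h1 | h1
        · rw [nestLE_iff_of_mem a.2] at h1; omega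
        · exact h a y h1
        · omega
        · rcases nest_or_left y.2 b.2 hyb with h2 | h2 | h2 | h2
          · have n3 := ne_of_mem_of_mem y.2 b.2 hyb (bmax_mem (π.nonempty_of_mem _ y.2))
              (bmax_mem (π.nonempty_of_mem _ b.2))
            rw [nestLE_iff_of_mem b.2] at h2; omega
          · rw [hg]; exact h b y h2
          · by_contra hlt'
            rw [Fin.le_def] at hlt'
            exact hsep ⟨y, _, bmin_mem (π.nonempty_of_mem _ y.2), h1, by omega,
              show (g y : ℕ) < g a by omega⟩
          · omega
    · by_cases hy : y = a ∨ y = b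
      · rw [if_pos hy, if_pos hy, if_neg hx, if_neg hx] at hxy
        rw [hgx y hy]
        exact h x a ((nestLE_iff_of_mem a.2).2 ⟨hxy.1, by omega⟩)
      · rw [if_neg hx, if_neg hx, if_neg hy, if_neg hy] at hxy
        exact h x y ((nestLE_iff_of_mem y.2).2 hxy)

/-- By monotonicity an intermediate block would share the value of `a` and `b`, but no third block
does. -/
theorem isNestedPair_of_collision
    (hinj : ∀ x y : π.blocks, x ≠ y → g x = g y → x = a ∧ y = b ∨ x = b ∧ y = a)
    (hmono : ∀ x y : π.blocks, NestLE x y → g x ≤ g y) (hne : a ≠ b) (hg : g a = g b)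
    (hab : NestLE a.1 b) : π.IsNestedPair a b := by
  refine ⟨a.2, b.2, fun e => hne (Subtype.ext e), hab, fun d hd h1 h2 => ?_⟩
  have e1 := hmono a ⟨d, hd⟩ h1
  have e2 := hmono ⟨d, hd⟩ b h2
  have e3 : g ⟨d, hd⟩ = g a := le_antisymm (hg ▸ e2) e1
  by_cases hda : (⟨d, hd⟩ : π.blocks) = a
  · exact Or.inl (congrArg Subtype.val hda)
  · rcases hinj _ _ hda e3 with h | h
    · exact (hda h.1).elim
    · exact Or.inr (congrArg Subtype.val h.1)

/-- The chain is built from left to right. The block containing the integer after the current block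
must start there, since otherwise it would surround the current block, hence `a`; it must also be
`b` or end before `b`, since otherwise it would surround `b`. A surrounding block has a value no
larger than that of `a`, thus smaller because only `a` and `b` collide, and it would separate the
pair. -/
theorem isClosePair_of_collision (hS : ∃ N, π.support = Finset.Icc 1 N)
    (hinj : ∀ x y : π.blocks, x ≠ y → g x = g y → x = a ∧ y = b ∨ x = b ∧ y = a)
    (hmono : ∀ x y : π.blocks, NestLE x y → g x ≤ g y) (hg : g a = g b)
    (hlt : bmax a.1 < bmin b.1) (hsep : ¬ π.Separated (fun x => g x) a b (g a)) :
    π.IsClosePair a b := by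
  have hne : a.1 ≠ b := by
    intro e
    have := bmin_le_bmax a.2
    rw [e] at hlt this
    omega
  refine ⟨a.2, b.2, hne, hlt, Or.inl ?_⟩
  obtain ⟨N, hN⟩ := hS
  have na := π.nonempty_of_mem _ a.2
  have nb := π.nonempty_of_mem _ b.2
  have lb := bmin_le_bmax b.2
  have hlow : ∀ d : π.blocks, d ≠ a → d ≠ b → g d ≤ g a → ∀ z ∈ d.1, bmax a.1 < z →
      z < bmin b.1 → False := by
    intro d hda hdb hle z hz h1 h2
    refine hsep ⟨d, z, hz, h1, h2, Fin.lt_def.1 (lt_of_le_of_ne hle fun e => ?_)⟩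
    rcases hinj d a hda e with h | h
    · exact hda h.1
    · exact hdb h.1
  have step : ∀ c : π.blocks, Relation.ReflTransGen π.Follows a c → bmax c.1 < bmin b.1 →
      ∃ d : π.blocks, π.Follows c d ∧ (d = b ∨ bmax d.1 < bmin b.1) := by
    intro c hc hcb
    obtain ⟨_, hc1, hc2⟩ := chain_bounds a.2 hc
    -- This is where the support being an interval is used: the next integer belongs to some block.
    have hw : bmax c.1 + 1 ∈ π.support := by
      have hb' := mem_support b.2 (bmin_mem nb)
      rw [hN, Finset.mem_Icc] at hb' ⊢
      omega
    obtain ⟨d, hd, hwd⟩ := mem_support_iff.1 hw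
    have hmin := bmin_le hwd
    have hmax := le_bmax hwd
    have hdc : d ≠ c := by rintro rfl; omega
    have hda : d ≠ a := by rintro rfl; omega
    have hbw : d ≠ b → bmax c.1 + 1 < bmin b.1 := by
      intro hdb
      have := ne_of_mem_of_mem hd b.2 hdb hwd (bmin_mem nb)
      omega
    have hmin' : bmax c.1 + 1 = bmin d := by
      have := bmin_le_bmax c.2
      rcases nest_or_left hd c.2 hdc with h | h | h | h
      · obtain ⟨h1, h2⟩ := (chain_nest_iff hc hd).2 ⟨h, hdc⟩
        have hdb : d ≠ b := by
          rintro rfl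
          rw [nestLE_iff_of_mem a.2] at h1
          have := bmin_le_bmax a.2
          omega
        exact (hlow ⟨d, hd⟩ (fun e => h2 (congrArg Subtype.val e))
          (fun e => hdb (congrArg Subtype.val e)) (hmono ⟨d, hd⟩ a h1) _ hwd (by omega)
          (hbw hdb)).elim
      · rw [nestLE_iff_of_mem hd] at h; omega
      · omega
      · omega
    refine ⟨⟨d, hd⟩, ⟨c.2, hd, hmin'⟩, ?_⟩
    by_cases hdb : d = b
    · exact Or.inl (Subtype.ext hdb)
    · right
      have hw' := hbw hdb
      rcases nest_or_left hd b.2 hdb with h | h | h | h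
      · exact (hlow ⟨d, hd⟩ (fun e => hda (congrArg Subtype.val e))
          (fun e => hdb (congrArg Subtype.val e)) (hg ▸ hmono ⟨d, hd⟩ b h) _ hwd (by omega)
          hw').elim
      · rw [nestLE_iff_of_mem hd] at h; omega
      · exact h
      · omega
  have main : ∀ k : ℕ, ∀ c : π.blocks, Relation.ReflTransGen π.Follows a c →
      bmax c.1 < bmin b.1 → bmin b.1 - bmax c.1 ≤ k → Relation.ReflTransGen π.Follows a b := by
    intro k
    induction k with
    | zero => intro c _ h1 h2; omega
    | succ k ih =>
      intro c hc h1 h2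
      obtain ⟨d, hd, rfl | hdb⟩ := step c hc h1
      · exact hc.tail hd
      · refine ih d (hc.tail hd) hdb ?_
        have := hd.2.2
        have := bmin_le_bmax d.2
        omega
  exact main _ a .refl hlt le_rfl

end

/-! ### Counting collisions -/

/-- Triples are fibred over their pair of blocks. When `Φ` amounts to monotonicity on the merged
partition, `le_merge` counts each fibre. -/
theorem card_eq_sum_le_merge {π : NCPartition} {m : ℕ} (hm : π.blocks.card = m + 1)
    (Φ : (π.blocks → Fin m) → π.blocks → π.blocks → Prop) (s : Finset (Finset ℕ × Finset ℕ))
    (hs : ∀ p ∈ s, p.1 ∈ π.blocks ∧ p.2 ∈ π.blocks ∧ p.1 ≠ p.2)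
    (h₁ : ∀ g a b, Φ g a b → (a.1, b.1) ∈ s)
    (h₂ : ∀ g a b, (a.1, b.1) ∈ s →
      (Φ g a b ↔ Function.Surjective g ∧ g a = g b ∧ π.MergedMono a b g))
    {T : Finset ((π.blocks → Fin m) × π.blocks × π.blocks)}
    (hT : ∀ t, t ∈ T ↔ Φ t.1 t.2.1 t.2.2) : T.card = ∑ p ∈ s, le (π.merge p.1 p.2) := by
  classical
  rw [Finset.card_eq_sum_card_fiberwise (f := fun t => (t.2.1.1, t.2.2.1)) (t := s)
    (fun t ht => h₁ _ _ _ ((hT t).1 ht))]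
  refine Finset.sum_congr rfl fun ⟨a, b⟩ hp => ?_
  obtain ⟨ha, hb, hab⟩ := hs _ hp
  rw [le_merge hm ⟨a, ha⟩ ⟨b, hb⟩ fun e => hab (congrArg Subtype.val e)]
  symm
  refine Finset.card_nbij (fun g => (g, ⟨a, ha⟩, ⟨b, hb⟩)) ?_ ?_ ?_
  · intro g hg
    simp only [Finset.coe_filter, Finset.mem_univ, true_and, Set.mem_ofPred_eq, hT,
      and_true] at hg ⊢
    exact (h₂ g ⟨a, ha⟩ ⟨b, hb⟩ hp).2 hg
  · intro g _ g' _ h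
    exact congrArg Prod.fst h
  · rintro ⟨g, ⟨a', ha'⟩, ⟨b', hb'⟩⟩ ht
    simp only [Finset.coe_filter, Set.mem_ofPred_eq, hT, Prod.mk.injEq] at ht
    obtain ⟨h, rfl, rfl⟩ := ht
    refine ⟨g, ?_, rfl⟩
    simp only [Finset.coe_filter, Finset.mem_univ, true_and, Set.mem_ofPred_eq]
    exact (h₂ g _ _ hp).1 h

section

variable (π : NCPartition) (m : ℕ)

/-- The surjections that preserve the nesting order. -/
def MonoSurj (g : π.blocks → Fin m) : Prop :=
  Function.Surjective g ∧ ∀ x y : π.blocks, NestLE x y → g x ≤ g y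

open scoped Classical in
/-- Order preserving surjections with a collision of a block and a block to its right. -/
noncomputable def leftCollisions : Finset ((π.blocks → Fin m) × π.blocks × π.blocks) :=
  Finset.univ.filter fun t => π.MonoSurj m t.1 ∧ t.1 t.2.1 = t.1 t.2.2 ∧
    bmax t.2.1 < bmin t.2.2

variable {π m}

theorem ne_of_left {a b : π.blocks} (h : bmax a.1 < bmin b.1) : a ≠ b := by
  rintro rfl
  have := bmin_le_bmax a.2
  omega

open scoped Classical in
theorem card_nested_collisions (hm : π.blocks.card = m + 1) :
    (Finset.univ.filter fun t : (π.blocks → Fin m) × π.blocks × π.blocks =>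
      π.MonoSurj m t.1 ∧ t.2.1 ≠ t.2.2 ∧ t.1 t.2.1 = t.1 t.2.2 ∧ NestLE t.2.1.1 t.2.2).card =
      ∑ p ∈ π.nestedPairs, le (π.merge p.1 p.2) := by
  have hB : Fintype.card π.blocks = m + 1 := by rw [Fintype.card_coe, hm]
  refine card_eq_sum_le_merge hm
    (fun g a b => π.MonoSurj m g ∧ a ≠ b ∧ g a = g b ∧ NestLE a.1 b) _ ?_ ?_ ?_
    fun t => by simp
  · intro p hp
    have h := (Finset.mem_filter.1 hp).2
    exact ⟨h.1, h.2.1, h.2.2.1⟩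
  · rintro g a b ⟨⟨h1, h2⟩, h3, h4, h5⟩
    refine Finset.mem_filter.2 ⟨Finset.mem_product.2 ⟨a.2, b.2⟩, ?_⟩
    exact isNestedPair_of_collision (fun x y => collision_unique hB h1 h3 h4) h2 h3 h4 h5
  · intro g a b hp
    have h := (Finset.mem_filter.1 hp).2
    constructor
    · rintro ⟨⟨h1, h2⟩, h3, h4, h5⟩
      exact ⟨h1, h4, (mergedMono_iff_of_nested h h4).2 h2⟩
    · rintro ⟨h1, h2, h3⟩
      exact ⟨⟨h1, (mergedMono_iff_of_nested h h2).1 h3⟩,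
        fun e => h.2.2.1 (congrArg Subtype.val e), h2, h.2.2.2.1⟩

open scoped Classical in
theorem card_unseparated_collisions (hm : π.blocks.card = m + 1)
    (hS : ∃ N, π.support = Finset.Icc 1 N) :
    ((π.leftCollisions m).filter fun t =>
      ¬ π.Separated (fun x => t.1 x) t.2.1 t.2.2 (t.1 t.2.1)).card =
      ∑ p ∈ π.closePairs, le (π.merge p.1 p.2) := by
  have hB : Fintype.card π.blocks = m + 1 := by rw [Fintype.card_coe, hm]
  rw [leftCollisions, Finset.filter_filter]
  refine card_eq_sum_le_merge hm
    (fun g a b => (π.MonoSurj m g ∧ g a = g b ∧ bmax a.1 < bmin b.1) ∧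
      ¬ π.Separated (fun x => g x) a b (g a)) _ ?_ ?_ ?_
    fun t => by simp
  · intro p hp
    have h := (Finset.mem_filter.1 hp).2
    exact ⟨h.1, h.2.1, h.2.2.1⟩
  · rintro g a b ⟨⟨⟨h1, h2⟩, h3, h4⟩, h5⟩
    refine Finset.mem_filter.2 ⟨Finset.mem_product.2 ⟨a.2, b.2⟩, ?_⟩
    exact isClosePair_of_collision hS (fun x y => collision_unique hB h1 (ne_of_left h4) h3)
      h2 h3 h4 h5
  · intro g a b hp
    have h := (Finset.mem_filter.1 hp).2
    constructor
    · rintro ⟨⟨⟨h1, h2⟩, h3, h4⟩, h5⟩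
      exact ⟨h1, h3, (mergedMono_iff_of_close h h3).2 ⟨h2, h5⟩⟩
    · rintro ⟨h1, h2, h3⟩
      obtain ⟨h4, h5⟩ := (mergedMono_iff_of_close h h2).1 h3
      exact ⟨⟨⟨h1, h4⟩, h2, h.2.2.2.1⟩, h5⟩

-- A surjection onto one value fewer than there are blocks has a single colliding pair. In a valid
-- colouring that pair is not nested, so it is side by side and separated; its left-to-right order
-- is determined.
open scoped Classical in
theorem card_separated_collisions (hm : π.blocks.card = m + 1) :
    ((π.leftCollisions m).filter fun t =>
      π.Separated (fun x => t.1 x) t.2.1 t.2.2 (t.1 t.2.1)).card = π.numSurj m := by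
  have hB : Fintype.card π.blocks = m + 1 := by rw [Fintype.card_coe, hm]
  rw [leftCollisions, Finset.filter_filter, numSurj]
  refine Finset.card_nbij Prod.fst ?_ ?_ ?_
  · rintro ⟨g, a, b⟩ ht
    simp only [Finset.coe_filter, Finset.mem_univ, true_and, Set.mem_ofPred_eq] at ht ⊢
    obtain ⟨⟨⟨h1, h2⟩, h3, h4⟩, h5⟩ := ht
    refine ⟨h1, validOnBlocks_iff.2 ⟨h2, fun x y hne hxy => ?_⟩⟩
    have la := bmin_le_bmax a.2
    have lb := bmin_le_bmax b.2
    rcases collision_unique hB h1 (ne_of_left h4) h3 hne (Fin.ext hxy) with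
      ⟨rfl, rfl⟩ | ⟨rfl, rfl⟩
    · refine ⟨fun h => ?_, fun _ => h5⟩
      rw [nestLE_iff_of_mem y.2] at h
      omega
    · refine ⟨fun h => ?_, fun h => ?_⟩
      · rw [nestLE_iff_of_mem y.2] at h
        omega
      · omega
  · rintro ⟨g, a, b⟩ ht ⟨g', a', b'⟩ ht' h
    simp only [Finset.coe_filter, Finset.mem_univ, true_and, Set.mem_ofPred_eq] at ht ht' h
    subst h
    obtain ⟨⟨⟨h1, h2⟩, h3, h4⟩, h5⟩ := ht
    obtain ⟨⟨-, h3', h4'⟩, -⟩ := ht'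
    rcases collision_unique hB h1 (ne_of_left h4) h3 (ne_of_left h4') h3' with
      ⟨rfl, rfl⟩ | ⟨rfl, rfl⟩
    · rfl
    · have := bmin_le_bmax a'.2
      have := bmin_le_bmax b'.2
      omega
  · intro g hg
    simp only [Finset.coe_filter, Finset.mem_univ, true_and, Set.mem_ofPred_eq] at hg
    obtain ⟨h1, h2⟩ := hg
    obtain ⟨hmono, hcol⟩ := validOnBlocks_iff.1 h2
    obtain ⟨x, y, hne, hxy⟩ := Fintype.exists_ne_map_eq_of_card_lt g (by rw [hB]; simp)
    have c1 := hcol x y hne (congrArg Fin.val hxy)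
    have c2 := hcol y x (Ne.symm hne) (congrArg Fin.val hxy.symm)
    have mem : ∀ a b : π.blocks, g a = g b → bmax a.1 < bmin b.1 →
        π.Separated (fun x => g x) a b (g a) → ∃ t : (π.blocks → Fin m) × π.blocks × π.blocks,
          ((π.MonoSurj m t.1 ∧ t.1 t.2.1 = t.1 t.2.2 ∧ bmax t.2.1.1 < bmin t.2.2.1) ∧
            π.Separated (fun x => t.1 x) t.2.1 t.2.2 (t.1 t.2.1)) ∧ t.1 = g :=
      fun a b h3 h4 h5 => ⟨(g, a, b), ⟨⟨⟨h1, hmono⟩, h3, h4⟩, h5⟩, rfl⟩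
    simp only [Set.mem_image, Finset.coe_filter, Finset.mem_univ, true_and, Set.mem_ofPred_eq]
    rcases nest_or_left x.2 y.2 (fun e => hne (Subtype.ext e)) with h | h | h | h
    · exact (c1.1 h).elim
    · exact (c2.1 h).elim
    · exact mem x y hxy h (c1.2 h)
    · exact mem y x hxy.symm h (c2.2 h)

/-- The left side counts collapsed linear extensions. An admissible order puts the outer block of a
nested pair first, while a side by side pair admits both orders, whence the factor 2. The latter
pairs are either separated, giving `numSurj`, or close. -/
theorem mul_le_blocks (hm : π.blocks.card = m + 1) (hS : ∃ N, π.support = Finset.Icc 1 N) :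
    m * le π.blocks = ∑ p ∈ π.nestedPairs, le (π.merge p.1 p.2) +
      2 * (π.numSurj m + ∑ p ∈ π.closePairs, le (π.merge p.1 p.2)) := by
  classical
  have hB : Fintype.card π.blocks = m + 1 := by rw [Fintype.card_coe, hm]
  rw [← card_separated_collisions hm, ← card_unseparated_collisions hm hS,
    Finset.card_filter_add_card_filter_not, ← card_nested_collisions hm,
    le_eq_card_surjective hm, mul_card_linearExtensions hB fun x y => NestLE x.1 y]
  -- The swapped copy of `leftCollisions` accounts for the triples that list the right-hand block
  -- first.
  have hswap : ((π.leftCollisions m).image fun t => (t.1, t.2.2, t.2.1)).card =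
      (π.leftCollisions m).card := by
    refine Finset.card_image_of_injective _ ?_
    rintro ⟨g, a, b⟩ ⟨g', a', b'⟩ h
    simp only [Prod.mk.injEq] at h ⊢
    tauto
  have hmem : ∀ g a b, (g, a, b) ∈ (π.leftCollisions m).image (fun t => (t.1, t.2.2, t.2.1)) ↔
      π.MonoSurj m g ∧ g a = g b ∧ bmax b.1 < bmin a.1 := by
    intro g a b
    simp only [Finset.mem_image, leftCollisions, Finset.mem_filter, Finset.mem_univ, true_and,
      Prod.exists, Prod.mk.injEq]
    constructor
    · rintro ⟨g, b, a, ⟨h1, h2, h3⟩, rfl, rfl, rfl⟩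
      exact ⟨h1, h2.symm, h3⟩
    · rintro ⟨h1, h2, h3⟩
      exact ⟨g, b, a, ⟨h1, h2.symm, h3⟩, rfl, rfl, rfl⟩
  rw [two_mul]
  conv_rhs => enter [2, 2]; rw [← hswap]
  rw [← Finset.card_union_of_disjoint, ← Finset.card_union_of_disjoint]
  · congr 1
    ext ⟨g, a, b⟩
    rw [Finset.mem_union, Finset.mem_union, hmem]
    simp only [leftCollisions, Finset.mem_filter, Finset.mem_univ, true_and]
    have la := bmin_le_bmax a.2
    have lb := bmin_le_bmax b.2
    constructor
    · rintro ⟨h1, h2, h3, h4, h5⟩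
      have hms : π.MonoSurj m g := ⟨h1, h2⟩
      rcases nest_or_left a.2 b.2 (fun e => h3 (Subtype.ext e)) with h | h | h | h
      · exact Or.inl ⟨hms, h3, h4, h⟩
      · exact (h5 h).elim
      · exact Or.inr (Or.inl ⟨hms, h4, h⟩)
      · exact Or.inr (Or.inr ⟨hms, h4, h⟩)
    · rintro (⟨h1, h2, h3, h4⟩ | ⟨h1, h2, h3⟩ | ⟨h1, h2, h3⟩)
      · exact ⟨h1.1, h1.2, h2, h3, fun h => h2 (Subtype.ext (nestLE_antisymm a.2 b.2 h4 h))⟩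
      · refine ⟨h1.1, h1.2, ne_of_left h3, h2, fun h => ?_⟩
        rw [nestLE_iff_of_mem a.2] at h
        omega
      · refine ⟨h1.1, h1.2, (ne_of_left h3).symm, h2, fun h => ?_⟩
        rw [nestLE_iff_of_mem a.2] at h
        omega
  · rw [Finset.disjoint_left]
    rintro ⟨g, a, b⟩ h h'
    rw [Finset.mem_union, hmem] at h'
    simp only [leftCollisions, Finset.mem_filter, Finset.mem_univ, true_and] at h h'
    have la := bmin_le_bmax a.2
    have lb := bmin_le_bmax b.2
    obtain ⟨-, -, -, h⟩ := h
    rw [nestLE_iff_of_mem b.2] at h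
    rcases h' with ⟨-, -, h'⟩ | ⟨-, -, h'⟩ <;> omega
  · rw [Finset.disjoint_left]
    rintro ⟨g, a, b⟩ h h'
    rw [hmem] at h'
    simp only [leftCollisions, Finset.mem_filter, Finset.mem_univ, true_and] at h
    have la := bmin_le_bmax a.2
    have lb := bmin_le_bmax b.2
    omega

theorem numSurj_card_blocks (π : NCPartition) : π.numSurj π.blocks.card = le π.blocks := by
  classical
  rw [le_eq_card_surjective rfl, numSurj]
  congr 1
  ext f
  simp only [Finset.mem_filter, Finset.mem_univ, true_and]
  refine and_congr_right fun hf => ?_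
  have hinj : Function.Injective f :=
    ((Fintype.bijective_iff_surjective_and_card f).2 ⟨hf, by simp⟩).1
  rw [validOnBlocks_iff]
  exact ⟨fun h => h.1, fun h => ⟨h, fun a b hne hab => (hne (hinj (Fin.ext hab))).elim⟩⟩

/-- Numbering the blocks by their minima is a linear extension. Positivity makes the leading
coefficient nonzero and so fixes the degree. -/
theorem le_blocks_pos (π : NCPartition) : 0 < le π.blocks := by
  classical
  have hinj : Set.InjOn bmin (π.blocks : Set (Finset ℕ)) := fun a ha b hb h => by
    by_contra hne
    exact bmin_ne ha hb hne h
  have hcard : (π.blocks.image bmin).card = π.blocks.card := Finset.card_image_of_injOn hinj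
  rw [le_eq_card_surjective rfl, Finset.card_pos]
  let e := (π.blocks.image bmin).orderIsoOfFin hcard
  refine ⟨fun b => e.symm ⟨bmin b.1, Finset.mem_image_of_mem _ b.2⟩, ?_⟩
  simp only [Finset.mem_filter, Finset.mem_univ, true_and]
  constructor
  · intro i
    obtain ⟨b, hb, h⟩ := Finset.mem_image.1 (e i).2
    refine ⟨⟨b, hb⟩, ?_⟩
    rw [OrderIso.symm_apply_eq]
    exact Subtype.ext h
  · intro b b' h
    rw [nestLE_iff_of_mem b'.2] at h
    rw [OrderIso.le_iff_le]
    exact h.1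

end

/-! ### Coefficients of the colouring polynomial -/

variable (K : Type*) [Field K]

theorem coeff_descPochhammer_self (m : ℕ) : (descPochhammer K m).coeff m = 1 := by
  have := monic_descPochhammer K m
  rwa [Polynomial.Monic, Polynomial.leadingCoeff, descPochhammer_natDegree] at this

/-- The roots are 0, 1, …, m, with sum m(m + 1)/2. -/
theorem coeff_descPochhammer_succ [CharZero K] (m : ℕ) :
    (descPochhammer K (m + 1)).coeff m = -((m : K) * (m + 1) / 2) := by
  induction m with
  | zero => simp
  | succ m ih =>
    rw [descPochhammer_succ_right, mul_sub, Polynomial.coeff_sub, Polynomial.coeff_mul_X, ih,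
      ← Polynomial.C_eq_natCast, Polynomial.coeff_mul_C,
      coeff_descPochhammer_self]
    push_cast
    ring

theorem coeff_descPochhammer_of_lt {m n : ℕ} (h : m < n) : (descPochhammer K m).coeff n = 0 :=
  Polynomial.coeff_eq_zero_of_natDegree_lt (by rwa [descPochhammer_natDegree])

theorem coeff_colorPoly (π : NCPartition) (n : ℕ) :
    (π.colorPoly K).coeff n = ∑ k ∈ Finset.range (π.blocks.card + 1),
      (π.numSurj k : K) / (k.factorial : K) * (descPochhammer K k).coeff n := by
  simp only [colorPoly, Polynomial.finsetSum_coeff, Polynomial.coeff_C_mul]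

theorem coeff_card_colorPoly (π : NCPartition) :
    (π.colorPoly K).coeff π.blocks.card = (le π.blocks : K) / (π.blocks.card.factorial : K) := by
  rw [coeff_colorPoly, Finset.sum_range_succ, Finset.sum_eq_zero, coeff_descPochhammer_self,
    numSurj_card_blocks, zero_add, mul_one]
  intro k hk
  rw [coeff_descPochhammer_of_lt K (Finset.mem_range.1 hk), mul_zero]

theorem degree_colorPoly [CharZero K] (π : NCPartition) :
    (π.colorPoly K).degree = (π.blocks.card : WithBot ℕ) := by
  apply Polynomial.degree_eq_of_le_of_coeff_ne_zero
  · rw [Polynomial.degree_le_iff_coeff_zero]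
    intro n hn
    rw [coeff_colorPoly]
    refine Finset.sum_eq_zero fun k hk => ?_
    rw [coeff_descPochhammer_of_lt, mul_zero]
    have := Nat.cast_lt.1 hn
    have := Finset.mem_range.1 hk
    omega
  · rw [coeff_card_colorPoly]
    exact div_ne_zero (Nat.cast_ne_zero.2 π.le_blocks_pos.ne')
      (Nat.cast_ne_zero.2 (Nat.factorial_ne_zero _))

/-- Only the terms of index m and m + 1 contribute, giving (s_m - m * le / 2) / m!; then
`mul_le_blocks` eliminates both s_m and `le`. -/
theorem coeff_colorPoly_sub_one [CharZero K] (π : NCPartition) {m : ℕ}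
    (hm : π.blocks.card = m + 1) (hS : ∃ N, π.support = Finset.Icc 1 N) :
    (π.colorPoly K).coeff m = -(1 / (m.factorial : K)) *
      (∑ p ∈ π.closePairs, (le (π.merge p.1 p.2) : K) +
        (1 / 2 : K) * ∑ p ∈ π.nestedPairs, (le (π.merge p.1 p.2) : K)) := by
  have hle := π.numSurj_card_blocks
  rw [coeff_colorPoly, hm, Finset.sum_range_succ, Finset.sum_range_succ, Finset.sum_eq_zero,
    coeff_descPochhammer_self, coeff_descPochhammer_succ, ← hm, hle, hm, Nat.factorial_succ]
  · have key := congrArg (Nat.cast (R := K)) (mul_le_blocks hm hS)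
    push_cast at key ⊢
    have h1 : (m.factorial : K) ≠ 0 := Nat.cast_ne_zero.2 m.factorial_ne_zero
    have h2 : (m : K) + 1 ≠ 0 := by exact_mod_cast Nat.succ_ne_zero m
    field_simp
    linear_combination -key
  · intro k hk
    rw [coeff_descPochhammer_of_lt K (Finset.mem_range.1 hk), mul_zero]

end NCPartition

end NoncrossingBialgebra

theorem corollary3p19 (K : Type*) [Field K] [CharZero K] :
    (∃! φ : NoncrossingBialgebra.NCAlg K →ₐ[K] Polynomial K,
      NoncrossingBialgebra.IsDoubleBialgebraHom φ) ∧
    ∀ φ : NoncrossingBialgebra.NCAlg K →ₐ[K] Polynomial K,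
      NoncrossingBialgebra.IsDoubleBialgebraHom φ →
      ∀ (π : NoncrossingBialgebra.NCP) (n : ℕ), π.blocks.card = n →
        (φ (MvPolynomial.X π)).degree = (n : WithBot ℕ) ∧
        (φ (MvPolynomial.X π)).leadingCoeff
          = (NoncrossingBialgebra.le π.blocks : K) / (n.factorial : K) ∧
        (φ (MvPolynomial.X π)).coeff (n - 1)
          = -(1 / ((n - 1).factorial : K)) *
            (∑ p ∈ π.closePairs, (NoncrossingBialgebra.le (π.merge p.1 p.2) : K) +
              (1 / 2 : K) *
                ∑ p ∈ π.nestedPairs, (NoncrossingBialgebra.le (π.merge p.1 p.2) : K)) := by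
  have hcol := NoncrossingBialgebra.colorHom_isDoubleBialgebraHom K
  refine ⟨⟨_, hcol, fun ψ hψ => hψ.unique hcol⟩, fun φ hφ π n hn => ?_⟩
  rw [hφ.unique hcol, NoncrossingBialgebra.colorHom_X]
  have hdeg := π.toNCPartition.degree_colorPoly K
  subst hn
  refine ⟨hdeg, ?_, ?_⟩
  · rw [Polynomial.leadingCoeff, Polynomial.natDegree_eq_of_degree_eq_some hdeg,
      NoncrossingBialgebra.NCPartition.coeff_card_colorPoly]
  -- A member of `NCP` has at least one block, so the truncated difference `n - 1` is a true
  -- predecessor.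
  · have hpos := Finset.card_pos.2 π.blocks_nonempty
    exact π.toNCPartition.coeff_colorPoly_sub_one K (by omega) ⟨_, π.support_eq⟩
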